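/- Let $R=\mathbb Z[q^{\pm1},(q-1)^{-1}]$. A finite graded subset of $\mathbb R$, up to isotopy, is a finite sequence of integers (the degrees of its points, listed from bottom to top). A graded Legendrian tangle in $J^1[0,1]$ from $X$ (left boundary) to $Y$ (right boundary) is described by its front: a horizontal composition, from left to right, of basic tangles, each of which consists of horizontal strands together with exactly one elementary tangle, namely a crossing $\sigma_{m,n}$ (a strand of degree $m$ going from lower left to upper right crosses a strand of degree $n$ going from upper left to lower right), a left cusp $\lambda_n$, or a right cusp $\rho_n$ (at both kinds of cusp the upper branch has degree $n$ and the lower branch degree $n+1$). Isotopy of tangles is the equivalence relation generated by sliding an elementary tangle past another one above or below it and by the three Legendrian Reidemeister moves. The skein $\mathfrak T(X,Y)$ is the free $R$-module on isotopy classes of tangles from $X$ to $Y$ modulo the following local relations, in which horizontal compositions are read from left to right: * (S1) on a lower strand of degree $n+1$ and an upper strand of degree $m$, $$1-q^{(-1)^{m-n}}\,\sigma_{n+1,m}\sigma_{m,n+1}=\delta_{m,n}(q-1)\,\rho_m\lambda_m-\delta_{m,n+1}(1-q^{-1})\,\sigma_{m,m};$$ * (S2) a closed component $\lambda_n\rho_n$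 can be removed at the cost of a factor $(q-1)^{-1}$; * (S3) a tangle containing a zigzag (a strand that enters a right cusp along its upper branch, leaves that cusp along its lower branch, which is the upper branch of a left cusp, and leaves the latter along its lower branch) is zero. No boundary skein relations are imposed. The skein of tangles is $\mathfrak T=\bigoplus_{X,Y}\mathfrak T(X,Y)$. A right cusp tangle is a tangle with a single right cusp and no left cusps such that every crossing involves at least one of the two strands starting at the cusp, these two strands do not cross each other, and no pair of strands crosses twice. A left cusp tangle is the mirror image, under reflection of the front in a vertical axis, of a right cusp tangle. A permutation braid is a tangle without cusps in which every pair of strands crosses at most once. **Proposition.** For all $X,Y$, the $R$-module $\mathfrak T(X,Y)$ is generated by the classes of tangles which are a horizontal composition, from left to right, of (1) a finite, possibly empty, sequence of right cusp tangles, (2) a permutation braid, (3) a finite, possibly empty, sequence of left cusp tangles. Consequently $\mathfrak T$ is generated as an $R$-module by tangles of this form. -/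

import Mathlib

namespace LegendrianTangle

/-! ### The ground ring `ℤ[q^±, (q-1)⁻¹]` -/

/-- The ring `ℤ[q^±, (q-1)⁻¹]`: the polynomial ring in one variable with the variable `q` and
`q - 1` inverted. -/
abbrev SkeinRing : Type :=
  Localization.Away (Polynomial.X * (Polynomial.X - 1) : Polynomial ℤ)

theorem isUnit_algebraMap_mul :
    IsUnit (algebraMap (Polynomial ℤ) SkeinRing Polynomial.X *
      (algebraMap (Polynomial ℤ) SkeinRing Polynomial.X - 1)) := by
  have h := IsLocalization.Away.algebraMap_isUnit (S := SkeinRing)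
    (Polynomial.X * (Polynomial.X - 1) : Polynomial ℤ)
  simpa using h

/-- The variable `q`, as a unit of the ground ring. -/
noncomputable def q : SkeinRingˣ := (isUnit_of_mul_isUnit_left isUnit_algebraMap_mul).unit

/-- The element `q - 1`, as a unit of the ground ring. -/
noncomputable def qSubOne : SkeinRingˣ := (isUnit_of_mul_isUnit_right isUnit_algebraMap_mul).unit

theorem coe_q : (q : SkeinRing) = algebraMap (Polynomial ℤ) SkeinRing Polynomial.X := rfl

theorem coe_qSubOne : (qSubOne : SkeinRing) = (q : SkeinRing) - 1 := rfl

/-! ### Graded tangles, drawn in the front projection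

A finite graded subset of `ℝ` up to isotopy is the list of the degrees of its points, read from
bottom to top. The positive `x`-axis points to the right, the positive `z`-axis points up. -/

/-- The elementary tangles other than the single horizontal strand.
* `crossing m n` (`σ_{m,n}`): a strand of degree `m` from the lower left to the upper right crosses
  a strand of degree `n` from the upper left to the lower right.
* `leftCusp n` (`λ_n`): a left cusp `≺`, upper branch of degree `n`, lower branch of degree `n + 1`.
* `rightCusp n` (`ρ_n`): a right cusp `≻`, upper branch of degree `n`, lower branch of degree
  `n + 1`. -/
inductive Elem : Type
  | crossing (m n : ℤ) : Elem
  | leftCusp (n : ℤ) : Elem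
  | rightCusp (n : ℤ) : Elem
  deriving DecidableEq

namespace Elem

/-- Left boundary, from bottom to top. -/
def src : Elem → List ℤ
  | crossing m n => [m, n]
  | leftCusp _ => []
  | rightCusp n => [n + 1, n]

/-- Right boundary, from bottom to top. -/
def tgt : Elem → List ℤ
  | crossing m n => [n, m]
  | leftCusp n => [n + 1, n]
  | rightCusp _ => []

/-- Reflection of the front in a vertical axis. -/
def mirror : Elem → Elem
  | crossing m n => crossing n m
  | leftCusp n => rightCusp n
  | rightCusp n => leftCusp n

end Elem

/-- A basic tangle: one non-identity elementary tangle with horizontal strands of degrees `lower`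
below it and of degrees `upper` above it. -/
structure Basic : Type where
  lower : List ℤ
  elem : Elem
  upper : List ℤ
  deriving DecidableEq

namespace Basic

/-- Left boundary, from bottom to top. -/
def src (b : Basic) : List ℤ := b.lower ++ b.elem.src ++ b.upper

/-- Right boundary, from bottom to top. -/
def tgt (b : Basic) : List ℤ := b.lower ++ b.elem.tgt ++ b.upper

/-- Reflection of the front in a vertical axis. -/
def mirror (b : Basic) : Basic := ⟨b.lower, b.elem.mirror, b.upper⟩

theorem src_mirror (b : Basic) : b.mirror.src = b.tgt := by
  rcases b with ⟨A, _ | _ | _, B⟩ <;> rfl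

theorem tgt_mirror (b : Basic) : b.mirror.tgt = b.src := by
  rcases b with ⟨A, _ | _ | _, B⟩ <;> rfl

end Basic

/-- `IsPath X w Y`: the basic tangles in the word `w`, read from left to right, have matching ends,
and their horizontal composition has left boundary `X` and right boundary `Y`. -/
def IsPath : List ℤ → List Basic → List ℤ → Prop
  | X, [], Y => X = Y
  | X, b :: w, Y => X = b.src ∧ IsPath b.tgt w Y

theorem isPath_append {X Y Z : List ℤ} {v w : List Basic} (hv : IsPath X v Y)
    (hw : IsPath Y w Z) : IsPath X (v ++ w) Z := by
  induction v generalizing X with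
  | nil => cases hv; exact hw
  | cons b v ih => exact ⟨hv.1, ih hv.2⟩

theorem isPath_mirror {X Y : List ℤ} {w : List Basic} (h : IsPath X w Y) :
    IsPath Y (w.reverse.map Basic.mirror) X := by
  induction w generalizing X with
  | nil => exact Eq.symm h
  | cons b w ih =>
    rw [List.reverse_cons, List.map_append]
    exact isPath_append (ih h.2) ⟨b.src_mirror.symm, by rw [b.tgt_mirror, h.1]; rfl⟩

/-- A (generic) graded Legendrian tangle with left boundary `X` and right boundary `Y`, given by its
front: a horizontal composition of basic tangles. -/
@[ext]
structure Tangle (X Y : List ℤ) : Type where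
  word : List Basic
  isPath : IsPath X word Y

namespace Tangle

/-- The tangle consisting of horizontal strands. -/
def id (X : List ℤ) : Tangle X X := ⟨[], rfl⟩

/-- Horizontal composition, `S` to the left of `T`. -/
def comp {X Y Z : List ℤ} (S : Tangle X Y) (T : Tangle Y Z) : Tangle X Z :=
  ⟨S.word ++ T.word, isPath_append S.isPath T.isPath⟩

/-- Reflection of the front in a vertical axis. -/
def mirror {X Y : List ℤ} (T : Tangle X Y) : Tangle Y X :=
  ⟨T.word.reverse.map Basic.mirror, isPath_mirror T.isPath⟩

end Tangle

/-! ### Legendrian isotopy -/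

/-- The basic moves of fronts, between horizontal strands of degrees `A` below and `B` above. -/
inductive LocalMove : List Basic → List Basic → Prop
  /-- Sliding an elementary tangle `e` past an elementary tangle `f` above it; `M` are the degrees
  of the strands between them. -/
  | slide (A M B : List ℤ) (e f : Elem) :
      LocalMove [⟨A, e, M ++ f.src ++ B⟩, ⟨A ++ e.tgt ++ M, f, B⟩]
        [⟨A ++ e.src ++ M, f, B⟩, ⟨A, e, M ++ f.tgt ++ B⟩]
  /-- First Reidemeister move, left cusp born above the strand. -/
  | reidemeister1_above (A B : List ℤ) (k : ℤ) :
      LocalMove [⟨A ++ [k + 1], .leftCusp k, B⟩, ⟨A, .crossing (k + 1) (k + 1), k :: B⟩,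
        ⟨A ++ [k + 1], .rightCusp k, B⟩] []
  /-- First Reidemeister move, left cusp born below the strand. -/
  | reidemeister1_below (A B : List ℤ) (k : ℤ) :
      LocalMove [⟨A, .leftCusp k, k :: B⟩, ⟨A ++ [k + 1], .crossing k k, B⟩,
        ⟨A, .rightCusp k, k :: B⟩] []
  /-- Second Reidemeister move: a strand of degree `n`, coming from below a left cusp, crosses both
  of its branches. -/
  | reidemeister2_left_above (A B : List ℤ) (k n : ℤ) :
      LocalMove [⟨A ++ [n], .leftCusp k, B⟩, ⟨A, .crossing n (k + 1), k :: B⟩,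
        ⟨A ++ [k + 1], .crossing n k, B⟩] [⟨A, .leftCusp k, n :: B⟩]
  /-- The same with the strand coming from above the left cusp. -/
  | reidemeister2_left_below (A B : List ℤ) (k n : ℤ) :
      LocalMove [⟨A, .leftCusp k, n :: B⟩, ⟨A ++ [k + 1], .crossing k n, B⟩,
        ⟨A, .crossing (k + 1) n, k :: B⟩] [⟨A ++ [n], .leftCusp k, B⟩]
  /-- Second Reidemeister move at a right cusp, the strand ending below the cusp. -/
  | reidemeister2_right_above (A B : List ℤ) (k n : ℤ) :
      LocalMove [⟨A ++ [k + 1], .crossing k n, B⟩, ⟨A, .crossing (k + 1) n, k :: B⟩,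
        ⟨A ++ [n], .rightCusp k, B⟩] [⟨A, .rightCusp k, n :: B⟩]
  /-- Second Reidemeister move at a right cusp, the strand ending above the cusp. -/
  | reidemeister2_right_below (A B : List ℤ) (k n : ℤ) :
      LocalMove [⟨A, .crossing n (k + 1), k :: B⟩, ⟨A ++ [k + 1], .crossing n k, B⟩,
        ⟨A, .rightCusp k, n :: B⟩] [⟨A ++ [n], .rightCusp k, B⟩]
  /-- Third Reidemeister move. -/
  | reidemeister3 (A B : List ℤ) (a b c : ℤ) :
      LocalMove [⟨A, .crossing a b, c :: B⟩, ⟨A ++ [b], .crossing a c, B⟩,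
        ⟨A, .crossing b c, a :: B⟩]
        [⟨A ++ [a], .crossing b c, B⟩, ⟨A, .crossing a c, b :: B⟩, ⟨A ++ [c], .crossing a b, B⟩]

/-- `S` and `T` differ by one basic move in some part of the front. -/
def Tangle.Move {X Y : List ℤ} (S T : Tangle X Y) : Prop :=
  ∃ u l l' v : List Basic, LocalMove l l' ∧ S.word = u ++ l ++ v ∧ T.word = u ++ l' ++ v

/-- Isotopy classes of graded Legendrian tangles from `X` to `Y`: the quotient of the set of fronts
by the equivalence relation generated by the basic moves. -/
def IsotopyClass (X Y : List ℤ) : Type := Quot (Tangle.Move (X := X) (Y := Y))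

/-- The isotopy class of a tangle. -/
def Tangle.isotopyClass {X Y : List ℤ} (T : Tangle X Y) : IsotopyClass X Y := Quot.mk _ T

/-! ### The skein of tangles -/

/-- The isotopy class of `T` as a basis element of the free module. -/
noncomputable def Tangle.free {X Y : List ℤ} (T : Tangle X Y) : IsotopyClass X Y →₀ SkeinRing :=
  Finsupp.single T.isotopyClass 1

/-- The skein relations, `SkeinRel x` meaning that `x = 0` is imposed. In each relation the tangles
agree outside of the displayed part, to the left of which they read `u` and to the right `v`; `A`
and `B` are the degrees of the strands below and above that part.

The relation (S1) for a lower strand of degree `n + 1` and an upper strand of degree `m` is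
`1 - q^((-1)^(m-n)) σσ = δ_{m,n} (q-1) ρλ - δ_{m,n+1} (1-q⁻¹) σ`, and is split
according to which of the terms on the right are present. -/
inductive SkeinRel {X Y : List ℤ} : (IsotopyClass X Y →₀ SkeinRing) → Prop
  /-- (S1), both terms on the right absent. -/
  | s1 (u v : List Basic) (A B : List ℤ) (m n : ℤ) (hmn : m ≠ n) (hmn' : m ≠ n + 1)
      (T₀ T₁ : Tangle X Y)
      (h₀ : T₀.word = u ++ v)
      (h₁ : T₁.word = u ++ [⟨A, .crossing (n + 1) m, B⟩, ⟨A, .crossing m (n + 1), B⟩] ++ v) :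
      SkeinRel (T₀.free - ((q ^ ((m - n).negOnePow : ℤ) : SkeinRingˣ) : SkeinRing) • T₁.free)
  /-- (S1) with `m = n`; then `q^((-1)^(m-n)) = q`. -/
  | s1_cusps (u v : List Basic) (A B : List ℤ) (n : ℤ) (T₀ T₁ T₂ : Tangle X Y)
      (h₀ : T₀.word = u ++ v)
      (h₁ : T₁.word = u ++ [⟨A, .crossing (n + 1) n, B⟩, ⟨A, .crossing n (n + 1), B⟩] ++ v)
      (h₂ : T₂.word = u ++ [⟨A, .rightCusp n, B⟩, ⟨A, .leftCusp n, B⟩] ++ v) :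
      SkeinRel (T₀.free - (q : SkeinRing) • T₁.free - ((q : SkeinRing) - 1) • T₂.free)
  /-- (S1) with `m = n + 1`; then `q^((-1)^(m-n)) = q⁻¹`. -/
  | s1_crossing (u v : List Basic) (A B : List ℤ) (m : ℤ) (T₀ T₁ T₂ : Tangle X Y)
      (h₀ : T₀.word = u ++ v)
      (h₁ : T₁.word = u ++ [⟨A, .crossing m m, B⟩, ⟨A, .crossing m m, B⟩] ++ v)
      (h₂ : T₂.word = u ++ [⟨A, .crossing m m, B⟩] ++ v) :
      SkeinRel (T₀.free - ((q⁻¹ : SkeinRingˣ) : SkeinRing) • T₁.free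
        + (1 - ((q⁻¹ : SkeinRingˣ) : SkeinRing)) • T₂.free)
  /-- (S2): a standard unknot can be removed at the cost of a factor `(q-1)⁻¹`. -/
  | s2 (u v : List Basic) (A B : List ℤ) (n : ℤ) (T₀ T₁ : Tangle X Y)
      (h₀ : T₀.word = u ++ v)
      (h₁ : T₁.word = u ++ [⟨A, .leftCusp n, B⟩, ⟨A, .rightCusp n, B⟩] ++ v) :
      SkeinRel (T₁.free - ((qSubOne⁻¹ : SkeinRingˣ) : SkeinRing) • T₀.free)
  /-- (S3): a tangle with a zigzag (stabilization) vanishes. The strand enters as the upper branch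
  of a right cusp and leaves as the lower branch of a left cusp. -/
  | s3 (u v : List Basic) (A B : List ℤ) (k : ℤ) (T : Tangle X Y)
      (h : T.word = u ++ [⟨A, .leftCusp (k + 1), k :: B⟩, ⟨A ++ [k + 1 + 1], .rightCusp k, B⟩] ++ v) :
      SkeinRel T.free

/-- The skein of graded Legendrian tangles with left boundary `X` and right boundary `Y` (no
boundary skein relations are imposed): the free module on isotopy classes modulo the submodule
generated by the skein relations. -/
abbrev Skein (X Y : List ℤ) : Type :=
  (IsotopyClass X Y →₀ SkeinRing) ⧸
    Submodule.span SkeinRing {x : IsotopyClass X Y →₀ SkeinRing | SkeinRel x}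

/-- The element of the skein represented by a tangle. -/
noncomputable def Tangle.toSkein {X Y : List ℤ} (T : Tangle X Y) : Skein X Y :=
  Submodule.Quotient.mk T.free

/-! ### Strands, cusp tangles and permutation braids -/

namespace Elem

/-- The elementary tangle is a crossing. -/
def IsCrossing : Elem → Prop
  | crossing _ _ => True
  | _ => False

end Elem

namespace Basic

/-- Follow a strand from left to right through a basic tangle: `i` is its height (number of strands
below it) on the left, the result its height on the right, or `none` if it ends in a right cusp. -/
def follow (b : Basic) (i : ℕ) : Option ℕ :=
  let p := b.lower.length
  match b.elem with
  | .crossing _ _ => if i = p then some (p + 1) else if i = p + 1 then some p else some i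
  | .leftCusp _ => if i < p then some i else some (i + 2)
  | .rightCusp _ => if i < p then some i else if i < p + 2 then none else some (i - 2)

/-- The strands at heights `i` and `j` on the left cross each other in the basic tangle. -/
def Crosses (b : Basic) (i j : ℕ) : Prop :=
  b.elem.IsCrossing ∧ ((i = b.lower.length ∧ j = b.lower.length + 1) ∨
    (j = b.lower.length ∧ i = b.lower.length + 1))

end Basic

/-- Follow the strand starting at height `i` of the left boundary through a word, up to the first
right cusp on it. -/
def followWord : List Basic → ℕ → Option ℕ
  | [], i => some i
  | b :: w, i => (b.follow i).bind (followWord w)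

open Classical in
/-- The number of crossings, in a word, between the strands starting at heights `i` and `j` of the
left boundary (each followed up to the first right cusp on it). -/
noncomputable def crossingNumber : List Basic → ℕ → ℕ → ℕ
  | [], _, _ => 0
  | b :: w, i, j => (if b.Crosses i j then 1 else 0) +
      (b.follow i).elim 0 fun i' => (b.follow j).elim 0 fun j' => crossingNumber w i' j'

namespace Tangle

/-- A permutation braid: no cusps, and any pair of strands crosses at most once. -/
def IsPermutationBraid {X Y : List ℤ} (T : Tangle X Y) : Prop :=
  (∀ b ∈ T.word, b.elem.IsCrossing) ∧ ∀ i j, crossingNumber T.word i j ≤ 1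

/-- A right cusp tangle: a single right cusp, no left cusps; the two strands `i`, `j` starting at
the cusp do not cross each other, all crossings involve one of these two strands, and no pair of
strands crosses twice. -/
def IsRightCuspTangle {X Y : List ℤ} (T : Tangle X Y) : Prop :=
  ∃ (u v : List Basic) (A B : List ℤ) (n : ℤ) (i j : ℕ),
    T.word = u ++ [⟨A, .rightCusp n, B⟩] ++ v ∧
    (∀ b ∈ u ++ v, b.elem.IsCrossing) ∧
    followWord u i = some A.length ∧ followWord u j = some (A.length + 1) ∧
    crossingNumber T.word i j = 0 ∧
    (∀ a b, a ≠ i → a ≠ j → b ≠ i → b ≠ j → crossingNumber T.word a b = 0) ∧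
    ∀ a b, crossingNumber T.word a b ≤ 1

/-- A left cusp tangle: the mirror image of a right cusp tangle. -/
def IsLeftCuspTangle {X Y : List ℤ} (T : Tangle X Y) : Prop :=
  T.mirror.IsRightCuspTangle

/-- A horizontal composition of finitely many (possibly zero) right cusp tangles. -/
inductive IsRightCuspSequence : ∀ {X Y : List ℤ}, Tangle X Y → Prop
  | id (X : List ℤ) : IsRightCuspSequence (Tangle.id X)
  | comp {X Y Z : List ℤ} (S : Tangle X Y) (T : Tangle Y Z) :
      S.IsRightCuspTangle → IsRightCuspSequence T → IsRightCuspSequence (S.comp T)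

/-- A horizontal composition of finitely many (possibly zero) left cusp tangles. -/
inductive IsLeftCuspSequence : ∀ {X Y : List ℤ}, Tangle X Y → Prop
  | id (X : List ℤ) : IsLeftCuspSequence (Tangle.id X)
  | comp {X Y Z : List ℤ} (S : Tangle X Y) (T : Tangle Y Z) :
      S.IsLeftCuspTangle → IsLeftCuspSequence T → IsLeftCuspSequence (S.comp T)

/-- From left to right: a sequence of right cusp tangles, a permutation braid, a sequence of left
cusp tangles. -/
def IsNormalForm {X Y : List ℤ} (T : Tangle X Y) : Prop :=
  ∃ (X' Y' : List ℤ) (R : Tangle X X') (P : Tangle X' Y') (L : Tangle Y' Y),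
    R.IsRightCuspSequence ∧ P.IsPermutationBraid ∧ L.IsLeftCuspSequence ∧
      T = (R.comp P).comp L

end Tangle

end LegendrianTangle

/-!
A front is a word of basic tangles. Its letters are absorbed from right to left into a standard
word, made of reflected left cusp words, a standard permutation braid and left cusp words. Each
absorption holds modulo words of smaller complexity, where the complexity consists of the number of
letters and the total number of strand ends; such words are handled by induction.

Two crossings of the same strands can be removed by (S1). Conversely, creating two crossings next to
the upper branch of a left cusp allows one to push a strand over the cusp, since Reidemeister moves
simplify the resulting terms, and comparing (S1) with (S2) shows that a left cusp followed by a
crossing of its two branches vanishes. Sliding a left cusp to the right past another elementary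
tangle lowers the complexity, because the other tangle then has fewer strands next to it. A left
cusp word followed by a right cusp is reduced by such slides, by (S2), by (S3) or by a Reidemeister
move. Reflection in a vertical axis takes care of the right cusps.
-/

namespace LegendrianTangle

/-! ### Words -/

theorem isPath_append_iff {X Z : List ℤ} {v w : List Basic} :
    IsPath X (v ++ w) Z ↔ ∃ Y, IsPath X v Y ∧ IsPath Y w Z := by
  refine ⟨fun h => ?_, fun ⟨Y, hv, hw⟩ => isPath_append hv hw⟩
  induction v generalizing X with
  | nil => exact ⟨X, rfl, h⟩
  | cons b v ih =>
    obtain ⟨Y, hv, hw⟩ := ih h.2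
    exact ⟨Y, ⟨h.1, hv⟩, hw⟩

theorem IsPath.tgt_unique {X Y Y' : List ℤ} {w : List Basic} (h : IsPath X w Y)
    (h' : IsPath X w Y') : Y = Y' := by
  induction w generalizing X with
  | nil => exact h.symm.trans h'
  | cons b w ih => exact ih h.2 h'.2

/-- The tangle described by a word, with horizontal strands of degrees `A` added below it and `B`
above it. -/
def whisker (A B : List ℤ) (w : List Basic) : List Basic :=
  w.map fun b => ⟨A ++ b.lower, b.elem, b.upper ++ B⟩

@[simp] theorem whisker_nil (A B : List ℤ) : whisker A B [] = [] := rfl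

@[simp] theorem whisker_cons (A B : List ℤ) (b : Basic) (w : List Basic) :
    whisker A B (b :: w) = ⟨A ++ b.lower, b.elem, b.upper ++ B⟩ :: whisker A B w := rfl

@[simp] theorem whisker_append (A B : List ℤ) (v w : List Basic) :
    whisker A B (v ++ w) = whisker A B v ++ whisker A B w := List.map_append

@[simp] theorem whisker_whisker (A B C D : List ℤ) (w : List Basic) :
    whisker A B (whisker C D w) = whisker (A ++ C) (D ++ B) w := by
  simp [whisker]

@[simp] theorem whisker_nil_nil (w : List Basic) : whisker [] [] w = w := by
  simp [whisker]

theorem isPath_whisker_iff {A B X Y : List ℤ} {w : List Basic} :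
    IsPath (A ++ X ++ B) (whisker A B w) (A ++ Y ++ B) ↔ IsPath X w Y := by
  induction w generalizing X with
  | nil => simp [IsPath]
  | cons b w ih =>
    have h_src : Basic.src ⟨A ++ b.lower, b.elem, b.upper ++ B⟩ = A ++ b.src ++ B := by
      simp [Basic.src]
    have h_tgt : Basic.tgt ⟨A ++ b.lower, b.elem, b.upper ++ B⟩ = A ++ b.tgt ++ B := by
      simp [Basic.tgt]
    simp only [whisker_cons, IsPath, h_src, h_tgt, ih, List.append_cancel_left_eq,
      List.append_cancel_right_eq]

theorem IsPath.whisker_ends {A B X Y Z Z' : List ℤ} {w : List Basic} (hw : IsPath X w Y)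
    (hne : w ≠ []) (h : IsPath Z (whisker A B w) Z') : Z = A ++ X ++ B ∧ Z' = A ++ Y ++ B := by
  obtain ⟨b, w, rfl⟩ := List.exists_cons_of_ne_nil hne
  have hZ : Z = A ++ X ++ B := by
    rw [h.1, hw.1]
    simp [Basic.src]
  subst hZ
  exact ⟨rfl, h.tgt_unique (isPath_whisker_iff.2 hw)⟩

/-- The reflection of a word in a vertical axis. -/
def reflect (w : List Basic) : List Basic := w.reverse.map Basic.mirror

@[simp] theorem reflect_nil : reflect [] = [] := rfl

@[simp] theorem reflect_cons (b : Basic) (w : List Basic) :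
    reflect (b :: w) = reflect w ++ [b.mirror] := by
  simp [reflect]

@[simp] theorem reflect_append (v w : List Basic) :
    reflect (v ++ w) = reflect w ++ reflect v := by
  simp [reflect]

@[simp] theorem Elem.mirror_mirror (e : Elem) : e.mirror.mirror = e := by cases e <;> rfl

theorem Elem.src_mirror (e : Elem) : e.mirror.src = e.tgt := by cases e <;> rfl

theorem Elem.tgt_mirror (e : Elem) : e.mirror.tgt = e.src := by cases e <;> rfl

@[simp] theorem Basic.mirror_mirror (b : Basic) : b.mirror.mirror = b := by
  simp [Basic.mirror]

@[simp] theorem reflect_reflect (w : List Basic) : reflect (reflect w) = w := by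
  induction w with
  | nil => rfl
  | cons b w ih => simp [ih]

@[simp] theorem reflect_whisker (A B : List ℤ) (w : List Basic) :
    reflect (whisker A B w) = whisker A B (reflect w) := by
  induction w with
  | nil => rfl
  | cons b w ih => simp [ih, Basic.mirror]

theorem isPath_reflect_iff {X Y : List ℤ} {w : List Basic} :
    IsPath X (reflect w) Y ↔ IsPath Y w X :=
  ⟨fun h => reflect_reflect w ▸ isPath_mirror h, isPath_mirror⟩

/-! ### Classes of words and local relations -/

open Classical in
/-- The class of a word in the skein, with the junk value `0` if the word is not the front of a
tangle from `X` to `Y`. -/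
noncomputable def skeinClass (X Y : List ℤ) (w : List Basic) : Skein X Y :=
  if h : IsPath X w Y then Tangle.toSkein ⟨w, h⟩ else 0

theorem skeinClass_of_isPath {X Y : List ℤ} {w : List Basic} (h : IsPath X w Y) :
    skeinClass X Y w = Tangle.toSkein ⟨w, h⟩ := dif_pos h

theorem skeinClass_of_not_isPath {X Y : List ℤ} {w : List Basic} (h : ¬ IsPath X w Y) :
    skeinClass X Y w = 0 := dif_neg h

/-- Local equality in the skein: exchanging `w` and `w'` in any part of any front does not change
its class. -/
def SkeinEq (w w' : List Basic) : Prop :=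
  ∀ (U V A B : List ℤ) (u v : List Basic),
    skeinClass U V (u ++ whisker A B w ++ v) = skeinClass U V (u ++ whisker A B w' ++ v)

namespace SkeinEq

variable {w w' w'' : List Basic}

theorem refl (w : List Basic) : SkeinEq w w := fun _ _ _ _ _ _ => rfl

theorem symm (h : SkeinEq w w') : SkeinEq w' w := fun U V A B u v => (h U V A B u v).symm

theorem trans (h : SkeinEq w w') (h' : SkeinEq w' w'') : SkeinEq w w'' :=
  fun U V A B u v => (h U V A B u v).trans (h' U V A B u v)

theorem congr (u v : List Basic) (h : SkeinEq w w') : SkeinEq (u ++ w ++ v) (u ++ w' ++ v) := by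
  intro U V A B u' v'
  simpa using h U V A B (u' ++ whisker A B u) (whisker A B v ++ v')

end SkeinEq

/-- Local spanning in the skein: in any part of any front, `w` can be replaced by a linear
combination of the words in `S`. -/
def SpannedBy (w : List Basic) (S : Set (List Basic)) : Prop :=
  ∀ (U V A B : List ℤ) (u v : List Basic),
    skeinClass U V (u ++ whisker A B w ++ v) ∈
      Submodule.span SkeinRing ((fun s => skeinClass U V (u ++ whisker A B s ++ v)) '' S)

namespace SpannedBy

variable {w : List Basic} {S S' : Set (List Basic)}

theorem of_mem (h : w ∈ S) : SpannedBy w S := fun _ _ _ _ _ _ =>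
  Submodule.subset_span ⟨w, h, rfl⟩

theorem trans (h : SpannedBy w S) (h' : ∀ s ∈ S, SpannedBy s S') : SpannedBy w S' := by
  intro U V A B u v
  refine Submodule.span_le.2 ?_ (h U V A B u v)
  rintro _ ⟨s, hs, rfl⟩
  exact h' s hs U V A B u v

theorem mono (h : SpannedBy w S) (hS : S ⊆ S') : SpannedBy w S' :=
  h.trans fun _ hs => of_mem (hS hs)

theorem congr (u v : List Basic) (h : SpannedBy w S) :
    SpannedBy (u ++ w ++ v) ((fun s => u ++ s ++ v) '' S) := by
  intro U V A B u' v'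
  simpa [Set.image_image] using h U V A B (u' ++ whisker A B u) (whisker A B v ++ v')

theorem whisker (A B : List ℤ) (h : SpannedBy w S) :
    SpannedBy (whisker A B w) (LegendrianTangle.whisker A B '' S) := by
  intro U V A' B' u v
  simpa [Set.image_image] using h U V (A' ++ A) (B ++ B') u v

theorem of_isPath (h : ∀ (U V A B : List ℤ) (u v : List Basic),
    IsPath U (u ++ LegendrianTangle.whisker A B w ++ v) V →
      skeinClass U V (u ++ LegendrianTangle.whisker A B w ++ v) ∈ Submodule.span SkeinRing
        ((fun s => skeinClass U V (u ++ LegendrianTangle.whisker A B s ++ v)) '' S)) :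
    SpannedBy w S := by
  intro U V A B u v
  by_cases hp : IsPath U (u ++ LegendrianTangle.whisker A B w ++ v) V
  · exact h U V A B u v hp
  · exact skeinClass_of_not_isPath hp ▸ zero_mem _

end SpannedBy

theorem SkeinEq.spannedBy {w w' : List Basic} (h : SkeinEq w w') : SpannedBy w {w'} := by
  intro U V A B u v
  rw [h U V A B u v]
  exact Submodule.subset_span ⟨w', rfl, rfl⟩

/-! ### Isotopies and skein relations for words -/

namespace LocalMove

variable {l l' : List Basic}

theorem whisker (A B : List ℤ) (h : LocalMove l l') :
    LocalMove (whisker A B l) (LegendrianTangle.whisker A B l') := by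
  cases h with
  | slide A' M B' e f => simpa using slide (A ++ A') M (B' ++ B) e f
  | reidemeister1_above A' B' k => simpa using reidemeister1_above (A ++ A') (B' ++ B) k
  | reidemeister1_below A' B' k => simpa using reidemeister1_below (A ++ A') (B' ++ B) k
  | reidemeister2_left_above A' B' k n =>
    simpa using reidemeister2_left_above (A ++ A') (B' ++ B) k n
  | reidemeister2_left_below A' B' k n =>
    simpa using reidemeister2_left_below (A ++ A') (B' ++ B) k n
  | reidemeister2_right_above A' B' k n =>
    simpa using reidemeister2_right_above (A ++ A') (B' ++ B) k n
  | reidemeister2_right_below A' B' k n =>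
    simpa using reidemeister2_right_below (A ++ A') (B' ++ B) k n
  | reidemeister3 A' B' a b c => simpa using reidemeister3 (A ++ A') (B' ++ B) a b c

theorem reflect (h : LocalMove l l') :
    LocalMove (reflect l) (LegendrianTangle.reflect l') ∨
      LocalMove (LegendrianTangle.reflect l') (LegendrianTangle.reflect l) := by
  cases h with
  | slide A M B e f =>
    have h := slide A M B e.mirror f.mirror
    exact .inr (by simpa [Basic.mirror, Elem.src_mirror, Elem.tgt_mirror] using h)
  | reidemeister1_above A B k => exact .inl (reidemeister1_above A B k)
  | reidemeister1_below A B k => exact .inl (reidemeister1_below A B k)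
  | reidemeister2_left_above A B k n => exact .inl (reidemeister2_right_above A B k n)
  | reidemeister2_left_below A B k n => exact .inl (reidemeister2_right_below A B k n)
  | reidemeister2_right_above A B k n => exact .inl (reidemeister2_left_above A B k n)
  | reidemeister2_right_below A B k n => exact .inl (reidemeister2_left_below A B k n)
  | reidemeister3 A B a b c => exact .inl (reidemeister3 A B c b a)

theorem isPath {X Y : List ℤ} (h : LocalMove l l') (hl : IsPath X l Y) : IsPath X l' Y := by
  cases h <;> simp only [IsPath, Basic.src, Basic.tgt, Elem.src, Elem.tgt] at hl ⊢ <;> simp_all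

theorem isPath_symm {X Y : List ℤ} (h : LocalMove l l') (hne : l' ≠ []) (hl : IsPath X l' Y) :
    IsPath X l Y := by
  cases h <;> simp only [IsPath, Basic.src, Basic.tgt, Elem.src, Elem.tgt] at hne hl ⊢ <;> simp_all

theorem skeinClass_eq {U V : List ℤ} {u v : List Basic} (h : LocalMove l l')
    (hp : IsPath U (u ++ l ++ v) V) :
    skeinClass U V (u ++ l ++ v) = skeinClass U V (u ++ l' ++ v) := by
  have hp' : IsPath U (u ++ l' ++ v) V := by
    simp only [isPath_append_iff] at hp ⊢
    obtain ⟨Y, ⟨X, hu, hl⟩, hv⟩ := hp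
    exact ⟨Y, ⟨X, hu, h.isPath hl⟩, hv⟩
  have h_iso : (⟨_, hp⟩ : Tangle U V).isotopyClass = (⟨_, hp'⟩ : Tangle U V).isotopyClass :=
    Quot.sound ⟨u, l, l', v, h, rfl, rfl⟩
  rw [skeinClass_of_isPath hp, skeinClass_of_isPath hp', Tangle.toSkein, Tangle.toSkein,
    Tangle.free, Tangle.free, h_iso]

theorem spannedBy (h : LocalMove l l') : SpannedBy l {l'} :=
  .of_isPath fun _ _ A B _ _ hp =>
    (h.whisker A B).skeinClass_eq hp ▸ Submodule.subset_span ⟨l', rfl, rfl⟩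

/-- The empty word is the front of a tangle with arbitrary ends, a nonempty word fixes its ends. -/
theorem skeinEq (h : LocalMove l l') (hne : l' ≠ []) : SkeinEq l l' := by
  intro U V A B u v
  by_cases hp : IsPath U (u ++ LegendrianTangle.whisker A B l ++ v) V
  · exact (h.whisker A B).skeinClass_eq hp
  have hp' : ¬ IsPath U (u ++ LegendrianTangle.whisker A B l' ++ v) V := by
    refine mt ?_ hp
    simp only [isPath_append_iff]
    rintro ⟨Y, ⟨X, hu, hl⟩, hv⟩
    have hne' : LegendrianTangle.whisker A B l' ≠ [] := by simpa [LegendrianTangle.whisker]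
    exact ⟨Y, ⟨X, hu, (h.whisker A B).isPath_symm hne' hl⟩, hv⟩
  rw [skeinClass_of_not_isPath hp, skeinClass_of_not_isPath hp']

end LocalMove

theorem mk_eq_zero_of_skeinRel {X Y : List ℤ} {x : IsotopyClass X Y →₀ SkeinRing}
    (h : SkeinRel x) : (Submodule.Quotient.mk x : Skein X Y) = 0 :=
  (Submodule.Quotient.mk_eq_zero _).2 (Submodule.subset_span h)

section SkeinRelations

variable {U V A B : List ℤ} {u v : List Basic}

/-- The relation (S1) for strands of degrees `a = n + 1` and `b = m`. -/
theorem skeinClass_create_crossings {a b : ℤ} (hu : IsPath U u (A ++ [a, b] ++ B))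
    (hv : IsPath (A ++ [a, b] ++ B) v V) :
    skeinClass U V (u ++ v) =
      ((q ^ ((b - (a - 1)).negOnePow : ℤ) : SkeinRingˣ) : SkeinRing) •
          skeinClass U V (u ++ [⟨A, .crossing a b, B⟩, ⟨A, .crossing b a, B⟩] ++ v) +
        (if a = b + 1 then (qSubOne : SkeinRing) else 0) •
          skeinClass U V (u ++ [⟨A, .rightCusp b, B⟩, ⟨A, .leftCusp b, B⟩] ++ v) -
        (if a = b then 1 - ((q⁻¹ : SkeinRingˣ) : SkeinRing) else 0) •
          skeinClass U V (u ++ [⟨A, .crossing a b, B⟩] ++ v) := by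
  have h₀ : IsPath U (u ++ v) V := isPath_append hu hv
  have h₁ : IsPath U (u ++ [⟨A, .crossing a b, B⟩, ⟨A, .crossing b a, B⟩] ++ v) V :=
    isPath_append (isPath_append hu ⟨rfl, rfl, rfl⟩) hv
  obtain ⟨n, rfl⟩ : ∃ n, a = n + 1 := ⟨a - 1, by ring⟩
  rw [skeinClass_of_isPath h₀, skeinClass_of_isPath h₁, add_sub_cancel_right]
  by_cases hbn : b = n
  · subst hbn
    have h₂ : IsPath U (u ++ [⟨A, .rightCusp b, B⟩, ⟨A, .leftCusp b, B⟩] ++ v) V :=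
      isPath_append (isPath_append hu ⟨rfl, rfl, rfl⟩) hv
    have h := mk_eq_zero_of_skeinRel (.s1_cusps u v A B b ⟨_, h₀⟩ ⟨_, h₁⟩ ⟨_, h₂⟩ rfl rfl rfl)
    rw [Submodule.Quotient.mk_sub, Submodule.Quotient.mk_sub, sub_sub, sub_eq_zero] at h
    rw [skeinClass_of_isPath h₂, if_pos rfl, if_neg (by simp), zero_smul, sub_zero, sub_self,
      Int.negOnePow_zero, Units.val_one, zpow_one, coe_qSubOne]
    exact h
  by_cases hbn' : b = n + 1
  · subst hbn'
    have h₂ : IsPath U (u ++ [⟨A, .crossing (n + 1) (n + 1), B⟩] ++ v) V :=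
      isPath_append (isPath_append hu ⟨rfl, rfl⟩) hv
    have h := mk_eq_zero_of_skeinRel
      (.s1_crossing u v A B (n + 1) ⟨_, h₀⟩ ⟨_, h₁⟩ ⟨_, h₂⟩ rfl rfl rfl)
    rw [Submodule.Quotient.mk_add, Submodule.Quotient.mk_sub, sub_add, sub_eq_zero] at h
    rw [skeinClass_of_isPath h₂, if_neg (by simp), if_pos rfl, zero_smul, add_zero,
      add_sub_cancel_left, Int.negOnePow_one, Units.val_neg, Units.val_one, zpow_neg_one]
    exact h
  · have h := mk_eq_zero_of_skeinRel
      (.s1 u v A B b n hbn hbn' ⟨_, h₀⟩ ⟨_, h₁⟩ rfl rfl)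
    rw [Submodule.Quotient.mk_sub, sub_eq_zero] at h
    rw [if_neg (by omega), if_neg (by omega), zero_smul, zero_smul, add_zero, sub_zero]
    exact h

theorem skeinClass_unknot {n : ℤ} (hu : IsPath U u (A ++ B)) (hv : IsPath (A ++ B) v V) :
    (qSubOne : SkeinRing) • skeinClass U V (u ++ [⟨A, .leftCusp n, B⟩, ⟨A, .rightCusp n, B⟩] ++ v) =
      skeinClass U V (u ++ v) := by
  have h_ends : IsPath (A ++ B) [⟨A, .leftCusp n, B⟩, ⟨A, .rightCusp n, B⟩] (A ++ B) := by
    simp [IsPath, Basic.src, Basic.tgt, Elem.src, Elem.tgt]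
  have h₀ : IsPath U (u ++ v) V := isPath_append hu hv
  have h₁ := isPath_append (isPath_append hu h_ends) hv
  have h := mk_eq_zero_of_skeinRel (SkeinRel.s2 u v A B n ⟨_, h₀⟩ ⟨_, h₁⟩ rfl rfl)
  rw [Submodule.Quotient.mk_sub, sub_eq_zero, Submodule.Quotient.mk_smul] at h
  rw [skeinClass_of_isPath h₀, skeinClass_of_isPath h₁]
  exact (congrArg ((qSubOne : SkeinRing) • ·) h).trans
    (by rw [smul_smul, Units.mul_inv, one_smul]; rfl)

end SkeinRelations

theorem ite_smul_mem {R M : Type*} [Semiring R] [AddCommMonoid M] [Module R M]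
    {N : Submodule R M} {p : Prop} [Decidable p] (c : R) {x : M} (h : p → x ∈ N) :
    (if p then c else 0) • x ∈ N := by
  split_ifs with hp
  · exact N.smul_mem c (h hp)
  · exact (zero_smul R x).symm ▸ N.zero_mem

theorem spannedBy_double_crossing (A B : List ℤ) (a b : ℤ) :
    SpannedBy [⟨A, .crossing a b, B⟩, ⟨A, .crossing b a, B⟩]
      {[], [⟨A, .crossing a b, B⟩], [⟨A, .rightCusp b, B⟩, ⟨A, .leftCusp b, B⟩]} := by
  refine .of_isPath fun U V A' B' u v hp => ?_
  simp only [isPath_append_iff] at hp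
  obtain ⟨Y, ⟨X, hu, hX, -, hY⟩, hv⟩ := hp
  subst hX hY
  have h := skeinClass_create_crossings hu hv
  rw [eq_sub_iff_add_eq, ← sub_eq_iff_eq_add] at h
  refine (Submodule.smul_mem_iff_of_isUnit _
    (q ^ ((b - (a - 1)).negOnePow : ℤ)).isUnit).1 (Eq.subst (motive := (· ∈ _)) h ?_)
  refine sub_mem (add_mem ?_ (ite_smul_mem _ fun _ => ?_)) (ite_smul_mem _ fun _ => ?_)
  · exact Submodule.subset_span ⟨[], by simp⟩
  · exact Submodule.subset_span ⟨[⟨A, .crossing a b, B⟩], by simp⟩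
  · exact Submodule.subset_span ⟨[⟨A, .rightCusp b, B⟩, ⟨A, .leftCusp b, B⟩], by simp⟩

theorem spannedBy_create_crossings {A B X Y : List ℤ} {a b : ℤ} {u v : List Basic}
    (hu : IsPath X u (A ++ [a, b] ++ B)) (hv : IsPath (A ++ [a, b] ++ B) v Y) (hne : u ++ v ≠ []) :
    SpannedBy (u ++ v) {w | w = u ++ [⟨A, .crossing a b, B⟩, ⟨A, .crossing b a, B⟩] ++ v ∨
      (a = b ∧ w = u ++ [⟨A, .crossing a b, B⟩] ++ v) ∨
      (a = b + 1 ∧ w = u ++ [⟨A, .rightCusp b, B⟩, ⟨A, .leftCusp b, B⟩] ++ v)} := by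
  refine .of_isPath fun U V A' B' u' v' hp => ?_
  rw [isPath_append_iff] at hp
  obtain ⟨Y', hp, hv'⟩ := hp
  obtain ⟨X', hu', hp⟩ := isPath_append_iff.1 hp
  obtain ⟨rfl, rfl⟩ := (isPath_append hu hv).whisker_ends hne hp
  have h_left := isPath_append hu' (isPath_whisker_iff.2 hu)
  have h_right := isPath_append (isPath_whisker_iff.2 hv) hv'
  have h_ends : A' ++ (A ++ [a, b] ++ B) ++ B' = (A' ++ A) ++ [a, b] ++ (B ++ B') := by simp
  rw [h_ends] at h_left h_right
  have h_context (w : List Basic) : u' ++ whisker A' B' (u ++ w ++ v) ++ v' =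
      (u' ++ whisker A' B' u) ++ whisker A' B' w ++ (whisker A' B' v ++ v') := by simp
  have h_create := skeinClass_create_crossings h_left h_right
  have h_empty := h_context []
  simp only [List.append_nil, whisker_nil] at h_empty
  rw [h_empty, h_create]
  refine sub_mem (add_mem (Submodule.smul_mem _ _ ?_) (ite_smul_mem _ fun h => ?_))
    (ite_smul_mem _ fun h => ?_)
  · exact Submodule.subset_span ⟨_, .inl rfl, by simp only [h_context]; rfl⟩
  · exact Submodule.subset_span ⟨_, .inr (.inr ⟨h, rfl⟩), by simp only [h_context]; rfl⟩
  · exact Submodule.subset_span ⟨_, .inr (.inl ⟨h, rfl⟩), by simp only [h_context]; rfl⟩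

theorem spannedBy_unknot (A B : List ℤ) (n : ℤ) :
    SpannedBy [⟨A, .leftCusp n, B⟩, ⟨A, .rightCusp n, B⟩] {[]} := by
  refine .of_isPath fun U V A' B' u v hp => ?_
  simp only [isPath_append_iff] at hp
  obtain ⟨Y, ⟨X, hu, hX, -, hY⟩, hv⟩ := hp
  subst hX hY
  have hu' : IsPath U u (A' ++ A ++ (B ++ B')) := by
    simpa [Basic.src, Elem.src] using hu
  have hv' : IsPath (A' ++ A ++ (B ++ B')) v V := by
    simpa [Basic.tgt, Elem.tgt] using hv
  refine (Submodule.smul_mem_iff_of_isUnit _ qSubOne.isUnit).1 ?_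
  simp only [whisker_cons, whisker_nil, Set.image_singleton, List.append_nil]
  rw [skeinClass_unknot hu' hv']
  exact Submodule.mem_span_singleton_self _

/-- Comparing (S1), at the two branches of the cusp, with (S2). -/
theorem spannedBy_twisted_leftCusp (A B : List ℤ) (n : ℤ) :
    SpannedBy [⟨A, .leftCusp n, B⟩, ⟨A, .crossing (n + 1) n, B⟩, ⟨A, .crossing n (n + 1), B⟩]
      ∅ := by
  refine .of_isPath fun U V A' B' u v hp => ?_
  simp only [isPath_append_iff] at hp
  obtain ⟨Y, ⟨X, hu, hX, -, -, hY⟩, hv⟩ := hp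
  subst hX hY
  have hu' : IsPath U u (A' ++ A ++ (B ++ B')) := by
    simpa [Basic.src, Elem.src] using hu
  have hv' : IsPath (A' ++ A ++ (B ++ B')) ([⟨A' ++ A, .leftCusp n, B ++ B'⟩] ++ v) V :=
    ⟨by simp [Basic.src, Elem.src], hv⟩
  have h_unknot := skeinClass_unknot (n := n) hu' hv'
  have h_cusp : IsPath U (u ++ [⟨A' ++ A, .leftCusp n, B ++ B'⟩])
      (A' ++ A ++ [n + 1, n] ++ (B ++ B')) :=
    isPath_append hu ⟨rfl, rfl⟩
  have h_create := skeinClass_create_crossings h_cusp hv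
  simp only [if_true, List.append_assoc, List.cons_append, List.nil_append] at h_unknot h_create
  rw [if_neg (by simp), zero_smul, sub_zero, h_unknot, right_eq_add] at h_create
  refine (Submodule.smul_mem_iff_of_isUnit _
    (q ^ ((n - (n + 1 - 1)).negOnePow : ℤ)).isUnit).1 ?_
  simpa only [Set.image_empty, Submodule.span_empty, Submodule.mem_bot, whisker_cons, whisker_nil,
    List.append_assoc, List.cons_append, List.nil_append] using h_create

theorem spannedBy_crossed_leftCusp (A B : List ℤ) (n : ℤ) :
    SpannedBy [⟨A, .leftCusp n, B⟩, ⟨A, .crossing (n + 1) n, B⟩] ∅ := by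
  have h_create := spannedBy_create_crossings (A := A) (B := B) (a := n) (b := n + 1)
    (u := [⟨A, .leftCusp n, B⟩, ⟨A, .crossing (n + 1) n, B⟩]) (v := []) ⟨rfl, rfl, rfl⟩ rfl
    (by simp)
  refine h_create.trans ?_
  rintro s (rfl | ⟨h, -⟩ | ⟨h, -⟩)
  · simpa using (spannedBy_twisted_leftCusp A B n).congr [] [⟨A, .crossing (n + 1) n, B⟩]
  · omega
  · omega

theorem spannedBy_zigzag (A B : List ℤ) (k : ℤ) :
    SpannedBy [⟨A, .leftCusp (k + 1), k :: B⟩, ⟨A ++ [k + 1 + 1], .rightCusp k, B⟩] ∅ := by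
  refine .of_isPath fun U V A' B' u v hp => ?_
  have h := mk_eq_zero_of_skeinRel (.s3 u v (A' ++ A) (B ++ B') k ⟨_, hp⟩ (by simp))
  rw [Set.image_empty, Submodule.span_empty, Submodule.mem_bot, skeinClass_of_isPath hp]
  exact h

theorem spannedBy_reflect_zigzag (A B : List ℤ) (k : ℤ) :
    SpannedBy [⟨A ++ [k + 1 + 1], .leftCusp k, B⟩, ⟨A, .rightCusp (k + 1), k :: B⟩] ∅ := by
  have h_move := (LocalMove.reidemeister2_right_above A B (k + 1) k).skeinEq (by simp)
  refine (h_move.symm.congr [⟨A ++ [k + 1 + 1], .leftCusp k, B⟩] []).spannedBy.trans ?_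
  rintro _ rfl
  have h_crossed := spannedBy_crossed_leftCusp (A ++ [k + 1 + 1]) B k
  simpa using h_crossed.congr []
    [⟨A, .crossing (k + 1 + 1) k, (k + 1) :: B⟩, ⟨A ++ [k], .rightCusp (k + 1), B⟩]

/-! ### Reflection of the skein -/

theorem IsotopyClass.mirror_eq {X Y : List ℤ} {S T : Tangle X Y} (h : S.Move T) :
    S.mirror.isotopyClass = T.mirror.isotopyClass := by
  obtain ⟨u, l, l', v, h, hS, hT⟩ := h
  have hS' : S.mirror.word = reflect v ++ reflect l ++ reflect u := by
    simpa [Tangle.mirror, reflect] using congrArg reflect hS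
  have hT' : T.mirror.word = reflect v ++ reflect l' ++ reflect u := by
    simpa [Tangle.mirror, reflect] using congrArg reflect hT
  rcases h.reflect with h | h
  · exact Quot.sound ⟨_, _, _, _, h, hS', hT'⟩
  · exact (Quot.sound ⟨_, _, _, _, h, hT', hS'⟩ : Quot.mk _ _ = Quot.mk _ _).symm

/-- Reflection in a vertical axis on isotopy classes of tangles. -/
def IsotopyClass.mirror {X Y : List ℤ} : IsotopyClass X Y → IsotopyClass Y X :=
  Quot.lift (fun T => T.mirror.isotopyClass) fun _ _ => mirror_eq

/-- Reflection in a vertical axis on formal linear combinations of isotopy classes. -/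
noncomputable def reflectFree (X Y : List ℤ) :
    (IsotopyClass X Y →₀ SkeinRing) →ₗ[SkeinRing] IsotopyClass Y X →₀ SkeinRing :=
  Finsupp.lmapDomain SkeinRing SkeinRing IsotopyClass.mirror

theorem reflectFree_free {X Y : List ℤ} (T : Tangle X Y) :
    reflectFree X Y T.free = T.mirror.free := Finsupp.mapDomain_single

theorem mk_reflectFree_eq_zero {X Y : List ℤ} {x : IsotopyClass X Y →₀ SkeinRing}
    (h : SkeinRel x) : (Submodule.Quotient.mk (reflectFree X Y x) : Skein Y X) = 0 := by
  have h_mirror {T : Tangle X Y} {w : List Basic} (hT : T.word = w) :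
      T.mirror.word = reflect w := congrArg reflect hT
  cases h with
  | s1 u v A B m n hmn hmn' T₀ T₁ h₀ h₁ =>
    simp only [map_sub, map_smul, reflectFree_free]
    exact mk_eq_zero_of_skeinRel (.s1 (reflect v) (reflect u) A B m n hmn hmn' _ _
      (by simp [h_mirror h₀]) (by simp [h_mirror h₁, Basic.mirror, Elem.mirror]))
  | s1_cusps u v A B n T₀ T₁ T₂ h₀ h₁ h₂ =>
    simp only [map_sub, map_smul, reflectFree_free]
    exact mk_eq_zero_of_skeinRel (.s1_cusps (reflect v) (reflect u) A B n _ _ _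
      (by simp [h_mirror h₀]) (by simp [h_mirror h₁, Basic.mirror, Elem.mirror])
      (by simp [h_mirror h₂, Basic.mirror, Elem.mirror]))
  | s1_crossing u v A B m T₀ T₁ T₂ h₀ h₁ h₂ =>
    simp only [map_sub, map_add, map_smul, reflectFree_free]
    exact mk_eq_zero_of_skeinRel (.s1_crossing (reflect v) (reflect u) A B m _ _ _
      (by simp [h_mirror h₀]) (by simp [h_mirror h₁, Basic.mirror, Elem.mirror])
      (by simp [h_mirror h₂, Basic.mirror, Elem.mirror]))
  | s2 u v A B n T₀ T₁ h₀ h₁ =>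
    simp only [map_sub, map_smul, reflectFree_free]
    exact mk_eq_zero_of_skeinRel (.s2 (reflect v) (reflect u) A B n _ _
      (by simp [h_mirror h₀]) (by simp [h_mirror h₁, Basic.mirror, Elem.mirror]))
  | s3 u v A B k T h =>
    have h_zigzag := spannedBy_reflect_zigzag A B k Y X [] [] (reflect v) (reflect u)
    have h_word : T.mirror.word = reflect v ++ whisker [] []
        [⟨A ++ [k + 1 + 1], .leftCusp k, B⟩, ⟨A, .rightCusp (k + 1), k :: B⟩] ++ reflect u := by
      simp [h_mirror h, Basic.mirror, Elem.mirror]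
    rw [Set.image_empty, Submodule.span_empty, Submodule.mem_bot, ← h_word,
      skeinClass_of_isPath T.mirror.isPath] at h_zigzag
    exact (congrArg _ (reflectFree_free T)).trans h_zigzag

/-- Reflection in a vertical axis as a linear map between skeins. -/
noncomputable def skeinReflection (X Y : List ℤ) : Skein X Y →ₗ[SkeinRing] Skein Y X :=
  Submodule.mapQ _ _ (reflectFree X Y) <| Submodule.span_le.2 fun _ h =>
    Submodule.mem_comap.2 ((Submodule.Quotient.mk_eq_zero _).1 (mk_reflectFree_eq_zero h))

theorem skeinClass_reflect (X Y : List ℤ) (w : List Basic) :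
    skeinClass Y X (reflect w) = skeinReflection X Y (skeinClass X Y w) := by
  by_cases h : IsPath X w Y
  · rw [skeinClass_of_isPath h, skeinClass_of_isPath (isPath_reflect_iff.2 h)]
    exact (congrArg Submodule.Quotient.mk (reflectFree_free ⟨w, h⟩)).symm
  · rw [skeinClass_of_not_isPath h, skeinClass_of_not_isPath (mt isPath_reflect_iff.1 h), map_zero]

theorem SpannedBy.reflect {w : List Basic} {S : Set (List Basic)} (h : SpannedBy w S) :
    SpannedBy (reflect w) (LegendrianTangle.reflect '' S) := by
  intro U V A B u v
  have h_context (s : List Basic) :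
      skeinClass U V (u ++ LegendrianTangle.whisker A B (LegendrianTangle.reflect s) ++ v) =
        skeinReflection V U (skeinClass V U (LegendrianTangle.reflect v ++
          LegendrianTangle.whisker A B s ++ LegendrianTangle.reflect u)) := by
    rw [← skeinClass_reflect]
    simp
  have h_map := Submodule.mem_map_of_mem (f := skeinReflection V U)
    (h V U A B (LegendrianTangle.reflect v) (LegendrianTangle.reflect u))
  rw [Submodule.map_span, Set.image_image] at h_map
  simpa only [Set.image_image, h_context] using h_map

/-! ### Reduction -/

/-- The complexity of a word: its number of letters, together with the total number of ends of its
letters, ordered componentwise. -/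
def complexity (w : List Basic) : ℕ × ℕ :=
  (w.length, (w.map fun b => b.src.length + b.tgt.length).sum)

@[simp] theorem complexity_nil : complexity [] = 0 := rfl

theorem complexity_cons (b : Basic) (w : List Basic) :
    complexity (b :: w) = (1, b.src.length + b.tgt.length) + complexity w := by
  simp [complexity, add_comm]

@[simp] theorem complexity_append (v w : List Basic) :
    complexity (v ++ w) = complexity v + complexity w := by
  simp [complexity]

@[simp] theorem complexity_reflect (w : List Basic) : complexity (reflect w) = complexity w := by
  induction w with
  | nil => rfl
  | cons b w ih =>
    rw [reflect_cons, complexity_append, ih, complexity_cons, complexity_cons, complexity_nil,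
      b.src_mirror, b.tgt_mirror, add_zero, add_comm b.tgt.length, add_comm]

theorem complexity_whisker (A B : List ℤ) (w : List Basic) :
    complexity (whisker A B w) = complexity w + (0, 2 * (A.length + B.length) * w.length) := by
  induction w with
  | nil => rfl
  | cons b w ih =>
    simp only [whisker_cons, complexity_cons, ih, Basic.src, Basic.tgt, List.length_append,
      List.length_cons, Prod.ext_iff, Prod.fst_add, Prod.snd_add]
    exact ⟨rfl, by ring⟩

theorem complexity_whisker_le {s w : List Basic} (A B : List ℤ)
    (h : complexity s ≤ complexity w) :
    complexity (whisker A B s) ≤ complexity (whisker A B w) := by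
  rw [complexity_whisker, complexity_whisker]
  exact add_le_add h ⟨le_rfl, Nat.mul_le_mul_left _ h.1⟩

theorem complexity_whisker_lt {s w : List Basic} (A B : List ℤ)
    (h : complexity s < complexity w) :
    complexity (whisker A B s) < complexity (whisker A B w) := by
  rw [complexity_whisker, complexity_whisker]
  exact add_lt_add_of_lt_of_le h ⟨le_rfl, Nat.mul_le_mul_left _ h.le.1⟩

/-- Locally in the skein, `w` is a linear combination of words of smaller complexity and of words in
`S` of at most the same complexity. -/
def ReducesTo (w : List Basic) (S : Set (List Basic)) : Prop :=
  SpannedBy w {s | complexity s < complexity w ∨ s ∈ S ∧ complexity s ≤ complexity w}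

namespace ReducesTo

variable {w w' : List Basic} {S S' : Set (List Basic)}

theorem of_mem (h : w ∈ S) : ReducesTo w S := SpannedBy.of_mem (.inr ⟨h, le_rfl⟩)

theorem trans (h : ReducesTo w S) (h' : ∀ s ∈ S, ReducesTo s S') : ReducesTo w S' := by
  refine SpannedBy.trans h ?_
  rintro s (hs | ⟨hs, hsw⟩)
  · exact .of_mem (.inl hs)
  · refine (h' s hs).mono ?_
    rintro t (ht | ⟨ht, hts⟩)
    · exact .inl (ht.trans_le hsw)
    · exact .inr ⟨ht, hts.trans hsw⟩

theorem mono (h : ReducesTo w S) (hS : S ⊆ S') : ReducesTo w S' :=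
  h.trans fun _ hs => of_mem (hS hs)

theorem of_empty (h : ReducesTo w ∅) : ReducesTo w S := h.mono (Set.empty_subset S)

theorem step (h : ReducesTo w {w'}) (h' : ReducesTo w' S) : ReducesTo w S :=
  h.trans fun _ hs => hs ▸ h'

theorem of_spannedBy_le (h : SpannedBy w {w'}) (hle : complexity w' ≤ complexity w) :
    ReducesTo w {w'} :=
  SpannedBy.mono h fun _ hs => .inr ⟨hs, hs ▸ hle⟩

theorem of_spannedBy_lt (h : SpannedBy w {w'}) (hlt : complexity w' < complexity w) :
    ReducesTo w ∅ :=
  SpannedBy.mono h fun _ hs => .inl (hs ▸ hlt)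

theorem of_spannedBy_empty (h : SpannedBy w ∅) : ReducesTo w ∅ := h.mono (Set.empty_subset _)

theorem congr (u v : List Basic) (h : ReducesTo w S) :
    ReducesTo (u ++ w ++ v) ((fun s => u ++ s ++ v) '' S) := by
  refine (SpannedBy.congr u v h).mono ?_
  rintro _ ⟨s, hs | ⟨hs, hsw⟩, rfl⟩
  · exact .inl (by simpa using hs)
  · exact .inr ⟨⟨s, hs, rfl⟩, by simpa using hsw⟩

theorem congr_single (u v : List Basic) (h : ReducesTo w {w'}) :
    ReducesTo (u ++ w ++ v) {u ++ w' ++ v} := by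
  simpa using h.congr u v

theorem congr_empty (u v : List Basic) (h : ReducesTo w ∅) : ReducesTo (u ++ w ++ v) ∅ := by
  simpa using h.congr u v

theorem whisker (A B : List ℤ) (h : ReducesTo w S) :
    ReducesTo (whisker A B w) (LegendrianTangle.whisker A B '' S) := by
  refine (SpannedBy.whisker A B h).mono ?_
  rintro _ ⟨s, hs | ⟨hs, hsw⟩, rfl⟩
  · exact .inl (complexity_whisker_lt A B hs)
  · exact .inr ⟨⟨s, hs, rfl⟩, complexity_whisker_le A B hsw⟩

theorem reflect (h : ReducesTo w S) :
    ReducesTo (reflect w) (LegendrianTangle.reflect '' S) := by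
  refine (SpannedBy.reflect h).mono ?_
  rintro _ ⟨s, hs | ⟨hs, hsw⟩, rfl⟩
  · exact .inl (by simpa using hs)
  · exact .inr ⟨⟨s, hs, rfl⟩, by simpa using hsw⟩

end ReducesTo

section Interchange

variable {X X' Y Y' : List ℤ} {u v : List Basic} (A M B : List ℤ)

theorem skeinEq_interchange_letter (b : Basic) (hv : IsPath Y v Y') :
    SkeinEq (whisker A (M ++ Y ++ B) [b] ++ whisker (A ++ b.tgt ++ M) B v)
      (whisker (A ++ b.src ++ M) B v ++ whisker A (M ++ Y' ++ B) [b]) := by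
  induction v generalizing Y with
  | nil =>
    cases hv
    simpa using SkeinEq.refl _
  | cons c v ih =>
    obtain ⟨rfl, hv⟩ := hv
    have h_slide : SkeinEq (whisker A (M ++ c.src ++ B) [b] ++ whisker (A ++ b.tgt ++ M) B [c])
        (whisker (A ++ b.src ++ M) B [c] ++ whisker A (M ++ c.tgt ++ B) [b]) := by
      simpa [Basic.src, Basic.tgt] using (LocalMove.slide (A ++ b.lower)
        (b.upper ++ M ++ c.lower) (c.upper ++ B) b.elem c.elem).skeinEq (by simp)
    have h_first := h_slide.congr [] (whisker (A ++ b.tgt ++ M) B v)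
    have h_rest := (ih hv).congr (whisker (A ++ b.src ++ M) B [c]) []
    simp only [List.nil_append, List.append_nil, List.append_assoc, whisker_cons, whisker_nil,
      List.cons_append] at h_first h_rest ⊢
    exact h_first.trans h_rest

theorem skeinEq_interchange (hu : IsPath X u X') (hv : IsPath Y v Y') :
    SkeinEq (whisker A (M ++ Y ++ B) u ++ whisker (A ++ X' ++ M) B v)
      (whisker (A ++ X ++ M) B v ++ whisker A (M ++ Y' ++ B) u) := by
  induction u generalizing X with
  | nil =>
    cases hu
    simpa using SkeinEq.refl _
  | cons b u ih =>
    obtain ⟨rfl, hu⟩ := hu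
    have h_rest := (ih hu).congr (whisker A (M ++ Y ++ B) [b]) []
    have h_first := (skeinEq_interchange_letter A M B b hv).congr [] (whisker A (M ++ Y' ++ B) u)
    simp only [List.nil_append, List.append_nil, List.append_assoc, whisker_cons, whisker_nil,
      List.cons_append] at h_rest h_first ⊢
    exact h_rest.trans h_first

theorem complexity_lower_upper :
    complexity (whisker A (M ++ Y ++ B) u ++ whisker (A ++ X' ++ M) B v) =
      complexity u + complexity v +
        (0, 2 * (A.length + M.length + B.length) * (u.length + v.length)) +
        (0, 2 * (Y.length * u.length + X'.length * v.length)) := by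
  simp only [complexity_append, complexity_whisker, List.length_append, Prod.ext_iff,
    Prod.fst_add, Prod.snd_add]
  exact ⟨by ring, by ring⟩

theorem reducesTo_interchange (hu : IsPath X u X') (hv : IsPath Y v Y')
    (h : Y'.length * u.length + X.length * v.length ≤ Y.length * u.length + X'.length * v.length) :
    ReducesTo (whisker A (M ++ Y ++ B) u ++ whisker (A ++ X' ++ M) B v)
      {whisker (A ++ X ++ M) B v ++ whisker A (M ++ Y' ++ B) u} := by
  refine .of_spannedBy_le (skeinEq_interchange A M B hu hv).spannedBy ?_
  rw [complexity_append, add_comm, ← complexity_append, complexity_lower_upper,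
    complexity_lower_upper]
  exact add_le_add le_rfl ⟨le_rfl, Nat.mul_le_mul_left 2 h⟩

theorem reducesTo_interchange_symm (hu : IsPath X u X') (hv : IsPath Y v Y')
    (h : Y.length * u.length + X'.length * v.length ≤ Y'.length * u.length + X.length * v.length) :
    ReducesTo (whisker (A ++ X ++ M) B v ++ whisker A (M ++ Y' ++ B) u)
      {whisker A (M ++ Y ++ B) u ++ whisker (A ++ X' ++ M) B v} := by
  refine .of_spannedBy_le (skeinEq_interchange A M B hu hv).symm.spannedBy ?_
  rw [complexity_append (whisker (A ++ X ++ M) B v), add_comm, ← complexity_append,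
    complexity_lower_upper, complexity_lower_upper]
  exact add_le_add le_rfl ⟨le_rfl, Nat.mul_le_mul_left 2 h⟩

theorem reducesTo_empty_interchange (hu : IsPath X u X') (hv : IsPath Y v Y')
    (h : Y'.length * u.length + X.length * v.length < Y.length * u.length + X'.length * v.length) :
    ReducesTo (whisker A (M ++ Y ++ B) u ++ whisker (A ++ X' ++ M) B v) ∅ := by
  refine .of_spannedBy_lt (skeinEq_interchange A M B hu hv).spannedBy ?_
  rw [complexity_append, add_comm, ← complexity_append, complexity_lower_upper,
    complexity_lower_upper]
  exact add_lt_add_of_le_of_lt le_rfl (Prod.mk_lt_mk_iff_right.2 (by omega))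

theorem reducesTo_empty_interchange_symm (hu : IsPath X u X') (hv : IsPath Y v Y')
    (h : Y.length * u.length + X'.length * v.length < Y'.length * u.length + X.length * v.length) :
    ReducesTo (whisker (A ++ X ++ M) B v ++ whisker A (M ++ Y' ++ B) u) ∅ := by
  refine .of_spannedBy_lt (skeinEq_interchange A M B hu hv).symm.spannedBy ?_
  rw [complexity_append (whisker (A ++ X ++ M) B v), add_comm, ← complexity_append,
    complexity_lower_upper, complexity_lower_upper]
  exact add_lt_add_of_le_of_lt le_rfl (Prod.mk_lt_mk_iff_right.2 (by omega))

end Interchange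

/-! ### Braids -/

attribute [local simp] Basic.src Basic.tgt Elem.src Elem.tgt

/-- Words all of whose letters are crossings. -/
def IsBraid (w : List Basic) : Prop := ∀ b ∈ w, b.elem.IsCrossing

theorem isBraid_whisker_iff {A B : List ℤ} {w : List Basic} :
    IsBraid (whisker A B w) ↔ IsBraid w := List.forall_mem_map

theorem Elem.isCrossing_mirror_iff {e : Elem} : e.mirror.IsCrossing ↔ e.IsCrossing := by
  cases e <;> rfl

theorem isBraid_reflect_iff {w : List Basic} : IsBraid (reflect w) ↔ IsBraid w := by
  simp [IsBraid, reflect, Basic.mirror, Elem.isCrossing_mirror_iff]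

theorem IsBraid.length_eq {X Y : List ℤ} {w : List Basic} (hw : IsBraid w) (h : IsPath X w Y) :
    X.length = Y.length := by
  induction w generalizing X with
  | nil => rw [show X = Y from h]
  | cons b w ih =>
    obtain ⟨rfl, h⟩ := h
    rw [← ih (fun c hc => hw c (List.mem_cons_of_mem _ hc)) h]
    have hb := hw b List.mem_cons_self
    rcases b with ⟨A, _ | _ | _, B⟩
    · simp
    · exact hb.elim
    · exact hb.elim

/-- The word in which a strand of degree `x`, starting right above strands `A`, crosses the strands
`M` right above it, while the strands `B` above those stay put. -/
def rise : List ℤ → ℤ → List ℤ → List ℤ → List Basic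
  | _, _, [], _ => []
  | A, x, m :: M, B => ⟨A, .crossing x m, M ++ B⟩ :: rise (A ++ [m]) x M B

@[simp] theorem rise_nil (A : List ℤ) (x : ℤ) (B : List ℤ) : rise A x [] B = [] := rfl

theorem rise_cons (A : List ℤ) (x m : ℤ) (M B : List ℤ) :
    rise A x (m :: M) B = ⟨A, .crossing x m, M ++ B⟩ :: rise (A ++ [m]) x M B := rfl

@[simp] theorem whisker_rise (C D A : List ℤ) (x : ℤ) (M B : List ℤ) :
    whisker C D (rise A x M B) = rise (C ++ A) x M (B ++ D) := by
  induction M generalizing A with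
  | nil => rfl
  | cons m M ih => simp [rise_cons, ih]

theorem rise_append (A : List ℤ) (x : ℤ) (M N B : List ℤ) :
    rise A x (M ++ N) B = rise A x M (N ++ B) ++ rise (A ++ M) x N B := by
  induction M generalizing A with
  | nil => simp
  | cons m M ih => simp [rise_cons, ih]

theorem isPath_rise (A : List ℤ) (x : ℤ) (M B : List ℤ) :
    IsPath (A ++ x :: (M ++ B)) (rise A x M B) (A ++ M ++ x :: B) := by
  induction M generalizing A with
  | nil => simp [IsPath]
  | cons m M ih =>
    refine ⟨by simp, ?_⟩
    simpa using ih (A ++ [m])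

theorem isPath_rise_bottom (x : ℤ) (M B : List ℤ) :
    IsPath (x :: (M ++ B)) (rise [] x M B) (M ++ x :: B) :=
  isPath_rise [] x M B

theorem isBraid_rise (A : List ℤ) (x : ℤ) (M B : List ℤ) : IsBraid (rise A x M B) := by
  induction M generalizing A with
  | nil => simp [IsBraid]
  | cons m M ih => exact List.forall_mem_cons.2 ⟨trivial, ih _⟩

/-- Repeated third Reidemeister moves. -/
theorem reducesTo_pass (a b : ℤ) (M B : List ℤ) :
    ReducesTo (⟨[], .crossing a b, M ++ B⟩ :: (rise [b] a M B ++ rise [] b M (a :: B)))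
      {rise [a] b M B ++ rise [] a M (b :: B) ++ [⟨M, .crossing a b, B⟩]} := by
  induction M with
  | nil => exact .of_mem (by simp)
  | cons m M ih =>
    have h_slide_a := (reducesTo_interchange_symm [] [] [] (u := [⟨[], .crossing b m, []⟩])
        ⟨rfl, rfl⟩ (isPath_rise_bottom a M B) (by simp)
      ).congr_single [⟨[], .crossing a b, m :: (M ++ B)⟩, ⟨[b], .crossing a m, M ++ B⟩]
        (rise [m] b M (a :: B))
    have h_move := (ReducesTo.of_spannedBy_le (LocalMove.reidemeister3 [] (M ++ B) a b m).spannedBy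
        (by simp +arith [complexity])
      ).congr_single [] (rise [m, b] a M B ++ rise [m] b M (a :: B))
    have h_pass := (ih.whisker [m] []).congr
      [⟨[a], .crossing b m, M ++ B⟩, ⟨[], .crossing a m, b :: (M ++ B)⟩] []
    have h_slide_b := (reducesTo_interchange [] [] [] (u := [⟨[], .crossing a m, []⟩])
        ⟨rfl, rfl⟩ (isPath_rise_bottom b M B)
        (by simp +arith)
      ).congr_single [⟨[a], .crossing b m, M ++ B⟩]
        (rise [m] a M (b :: B) ++ [⟨m :: M, .crossing a b, B⟩])
    simp only [rise_cons, whisker_cons, whisker_nil, whisker_append, whisker_rise,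
      Set.image_singleton, Basic.src, Basic.tgt, Elem.src, Elem.tgt, List.append_nil,
      List.nil_append, List.cons_append, List.append_assoc]
      at h_slide_a h_move h_pass h_slide_b ⊢
    exact h_slide_a.step (h_move.step (h_pass.step h_slide_b))

/-- Standard words for permutation braids: a standard word for the strands above the bottom one,
followed by the rise of the bottom strand to its final position. -/
inductive StandardBraid : List ℤ → List Basic → List ℤ → Prop
  | nil : StandardBraid [] [] []
  | cons {X : List ℤ} {w : List Basic} (x : ℤ) (M B : List ℤ) : StandardBraid X w (M ++ B) →
      StandardBraid (x :: X) (whisker [x] [] w ++ rise [] x M B) (M ++ x :: B)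

namespace StandardBraid

variable {X Y : List ℤ} {x : ℤ} {w p : List Basic}

theorem isPath (h : StandardBraid X w Y) : IsPath X w Y := by
  induction h with
  | nil => rfl
  | cons x M B _ ih =>
    exact isPath_append (by simpa using (isPath_whisker_iff (A := [x]) (B := [])).2 ih)
      (isPath_rise_bottom x M B)

theorem isBraid (h : StandardBraid X w Y) : IsBraid w := by
  induction h with
  | nil => simp [IsBraid]
  | cons x M B _ ih =>
    exact List.forall_mem_append.2 ⟨isBraid_whisker_iff.2 ih, isBraid_rise [] x M B⟩

theorem refl (X : List ℤ) : StandardBraid X [] X := by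
  induction X with
  | nil => exact .nil
  | cons x X ih => exact .cons x [] X ih

theorem exists_of_cons (h : StandardBraid (x :: X) p Y) :
    ∃ M B w, StandardBraid X w (M ++ B) ∧ p = whisker [x] [] w ++ rise [] x M B ∧
      Y = M ++ x :: B := by
  cases h with
  | cons _ M B h => exact ⟨M, B, _, h, rfl, rfl⟩

end StandardBraid

theorem reducesTo_double_crossing (A B : List ℤ) (a b : ℤ) :
    ReducesTo [⟨A, .crossing a b, B⟩, ⟨A, .crossing b a, B⟩] ∅ := by
  refine (spannedBy_double_crossing A B a b).mono ?_
  rintro s (rfl | rfl | rfl) <;> left <;>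
    simp +arith [complexity, Prod.lt_iff]

theorem reducesTo_slide_crossing {X Y : List ℤ} {w : List Basic} (a b : ℤ) (hw : IsPath X w Y)
    (hlen : X.length = Y.length) :
    ReducesTo (⟨[], .crossing a b, X⟩ :: whisker [b, a] [] w)
      {whisker [a, b] [] w ++ [⟨[], .crossing a b, Y⟩]} := by
  have h := reducesTo_interchange [] [] [] (u := [⟨[], .crossing a b, []⟩]) ⟨rfl, rfl⟩ hw
    (by simp [hlen])
  simpa using h

theorem reducesTo_cross_once (a b : ℤ) (M N B : List ℤ) :
    ReducesTo (⟨[], .crossing a b, M ++ (N ++ B)⟩ ::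
        (rise [b] a (M ++ N) B ++ rise [] b M (N ++ a :: B)))
      {rise [a] b M (N ++ B) ++ rise [] a (M ++ b :: N) B} := by
  have h_slide := (reducesTo_interchange_symm [] [] B (isPath_rise [] b M [])
      (isPath_rise [] a N []) (by simp)).congr_single
    (⟨[], .crossing a b, M ++ (N ++ B)⟩ :: rise [b] a M (N ++ B)) []
  have h_pass := (reducesTo_pass a b M (N ++ B)).congr_single [] (rise (M ++ [b]) a N B)
  simp only [rise_append, rise_cons, whisker_rise, List.append_nil, List.nil_append,
    List.cons_append, List.append_assoc] at h_slide h_pass ⊢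
  exact h_slide.step h_pass

theorem reducesTo_cross_twice (a b : ℤ) (M N B : List ℤ) :
    ReducesTo (⟨[], .crossing a b, M ++ (N ++ B)⟩ ::
        (rise [b] a M (N ++ B) ++ rise [] b (M ++ a :: N) B)) ∅ := by
  have h_pass := (reducesTo_pass a b M (N ++ B)).congr_single [] (rise M b (a :: N) B)
  have h_double := (reducesTo_double_crossing M (N ++ B) a b).congr_empty
    (rise [a] b M (N ++ B) ++ rise [] a M (b :: (N ++ B))) (rise (M ++ [a]) b N B)
  simp only [rise_append, rise_cons, List.nil_append, List.cons_append, List.append_assoc]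
    at h_pass h_double ⊢
  exact h_pass.step h_double

namespace StandardBraid

variable {Y A C : List ℤ} {a b : ℤ} {p : List Basic}

theorem reducesTo_crossing_bottom (h : StandardBraid (b :: a :: C) p Y) :
    ReducesTo (⟨[], .crossing a b, C⟩ :: p) {w | StandardBraid (a :: b :: C) w Y} := by
  obtain ⟨M, B, _, hb, rfl, rfl⟩ := h.exists_of_cons
  obtain ⟨M', B', w, hw, rfl, hMB⟩ := hb.exists_of_cons
  have h_slide := (reducesTo_slide_crossing a b hw.isPath
    (hw.isBraid.length_eq hw.isPath)).congr_single [] (rise [b] a M' B' ++ rise [] b M B)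
  simp only [whisker_append, whisker_whisker, whisker_rise, List.append_nil, List.nil_append,
    List.cons_append, List.append_assoc] at h_slide ⊢
  refine h_slide.step ?_
  have h_once (M N B : List ℤ) (hw : StandardBraid C w (M ++ (N ++ B))) :
      ReducesTo (whisker [a, b] [] w ++ ⟨[], .crossing a b, M ++ (N ++ B)⟩ ::
          (rise [b] a (M ++ N) B ++ rise [] b M (N ++ a :: B)))
        {w | StandardBraid (a :: b :: C) w (M ++ b :: (N ++ a :: B))} := by
    have h_cross := (reducesTo_cross_once a b M N B).congr_single (whisker [a, b] [] w) []
    have h_std := cons a (M ++ b :: N) B (by simpa using cons b M (N ++ B) hw)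
    simp only [whisker_append, whisker_whisker, whisker_rise, List.append_nil, List.nil_append,
      List.cons_append, List.append_assoc] at h_cross h_std ⊢
    exact h_cross.step (.of_mem h_std)
  rcases List.append_eq_append_iff.1 hMB with ⟨N, rfl, rfl⟩ | ⟨N, rfl, hB⟩
  · simpa using h_once M N B' (by simpa using hw)
  rcases List.cons_eq_append_iff.1 hB with ⟨rfl, rfl⟩ | ⟨N, rfl, rfl⟩
  · simpa using h_once M' [] B' (by simpa using hw)
  · have h_cross := (reducesTo_cross_twice a b M' N B).congr_empty (whisker [a, b] [] w) []
    simpa using h_cross.of_empty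

theorem reducesTo_crossing (h : StandardBraid (A ++ b :: a :: C) p Y) :
    ReducesTo (⟨A, .crossing a b, C⟩ :: p) {w | StandardBraid (A ++ a :: b :: C) w Y} := by
  induction A generalizing p Y with
  | nil => exact h.reducesTo_crossing_bottom
  | cons x A ih =>
    obtain ⟨M, B, w, hw, rfl, rfl⟩ := h.exists_of_cons
    have h_rest := ((ih hw).whisker [x] []).congr [] (rise [] x M B)
    simp only [whisker_cons, List.append_nil, List.nil_append, List.cons_append] at h_rest
    refine h_rest.mono ?_
    rintro _ ⟨_, ⟨s, hs, rfl⟩, rfl⟩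
    exact cons x M B hs

end StandardBraid

theorem IsBraid.reducesTo {X Y : List ℤ} {w : List Basic} (hw : IsBraid w) (h : IsPath X w Y) :
    ReducesTo w {p | StandardBraid X p Y} := by
  induction w generalizing X with
  | nil =>
    cases h
    exact .of_mem (.refl _)
  | cons b w ih =>
    obtain ⟨rfl, h⟩ := h
    obtain ⟨hb, hw⟩ := List.forall_mem_cons.1 hw
    have h_rest := (ih hw h).congr [b] []
    simp only [List.append_nil, List.cons_append, List.nil_append] at h_rest
    refine h_rest.trans ?_
    rintro _ ⟨p, hp, rfl⟩
    rcases b with ⟨A, ⟨m, n⟩ | _ | _, B⟩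
    · have hp' : StandardBraid (A ++ n :: m :: B) p Y := by
        simpa using hp
      simpa using hp'.reducesTo_crossing
    · exact hb.elim
    · exact hb.elim

/-! ### Left cusps -/

/-- The terms of (S1), applied at the upper branch of the cusp, simplify by Reidemeister moves. -/
theorem reducesTo_push_leftCusp (A B : List ℤ) (k n : ℤ) :
    ReducesTo [⟨A ++ [n], .leftCusp k, B⟩, ⟨A, .crossing n (k + 1), k :: B⟩]
      {[⟨A, .leftCusp k, n :: B⟩, ⟨A ++ [k + 1], .crossing k n, B⟩]} := by
  have h_create := spannedBy_create_crossings (A := A ++ [k + 1]) (B := B) (a := n) (b := k)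
    (u := [⟨A ++ [n], .leftCusp k, B⟩, ⟨A, .crossing n (k + 1), k :: B⟩])
    (v := []) (X := A ++ [n] ++ B) (Y := A ++ [k + 1] ++ [n, k] ++ B)
    (by simp [IsPath]) rfl (by simp)
  have h_slide := (LocalMove.reidemeister2_left_above A B k n).spannedBy
  refine SpannedBy.trans h_create ?_
  rintro s (rfl | ⟨rfl, rfl⟩ | ⟨rfl, rfl⟩)
  · refine (h_slide.congr [] [⟨A ++ [k + 1], .crossing k n, B⟩]).mono ?_
    rintro _ ⟨_, rfl, rfl⟩
    exact .inr ⟨rfl, by simp +arith [complexity]⟩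
  · refine h_slide.mono ?_
    rintro _ rfl
    exact .inl (by simp +arith [complexity, Prod.lt_iff])
  · have h_unkink := (LocalMove.reidemeister1_above A B k).spannedBy
    refine (h_unkink.congr [] [⟨A ++ [k + 1], .leftCusp k, B⟩]).mono ?_
    rintro _ ⟨_, rfl, rfl⟩
    exact .inl (by simp +arith [complexity, Prod.lt_iff])

/-- The word in which a left cusp of degree `k` is born right above strands `A`, and its upper
branch crosses the strands `M` right above it, while the strands `B` above those stay put. -/
def leftCuspWord (A : List ℤ) (k : ℤ) (M B : List ℤ) : List Basic :=
  ⟨A, .leftCusp k, M ++ B⟩ :: rise (A ++ [k + 1]) k M B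

/-- `w` is a standard word, from `X` to `Y`, for a left cusp tangle: the lower branch of its cusp
crosses no strand, and the upper branch rises to its final position. -/
def StandardLeftCusp (X : List ℤ) (w : List Basic) (Y : List ℤ) : Prop :=
  ∃ A k M B, X = A ++ (M ++ B) ∧ w = leftCuspWord A k M B ∧ Y = A ++ (k + 1) :: (M ++ k :: B)

theorem whisker_leftCuspWord (C D A : List ℤ) (k : ℤ) (M B : List ℤ) :
    whisker C D (leftCuspWord A k M B) = leftCuspWord (C ++ A) k M (B ++ D) := by
  simp [leftCuspWord]

theorem isPath_leftCuspWord (A : List ℤ) (k : ℤ) (M B : List ℤ) :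
    IsPath (A ++ (M ++ B)) (leftCuspWord A k M B) (A ++ (k + 1) :: (M ++ k :: B)) := by
  refine ⟨by simp, ?_⟩
  simpa using isPath_rise (A ++ [k + 1]) k M B

theorem StandardLeftCusp.isPath {X Y : List ℤ} {w : List Basic} (h : StandardLeftCusp X w Y) :
    IsPath X w Y := by
  obtain ⟨A, k, M, B, rfl, rfl, rfl⟩ := h
  exact isPath_leftCuspWord A k M B

theorem reducesTo_slide_leftCusp {X Y : List ℤ} {w : List Basic} (k : ℤ) (hw : IsPath X w Y)
    (hlen : X.length = Y.length) (hne : w ≠ []) :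
    ReducesTo (⟨[], .leftCusp k, X⟩ :: whisker [k + 1, k] [] w) ∅ := by
  have h := reducesTo_empty_interchange [] [] [] (u := [⟨[], .leftCusp k, []⟩]) ⟨rfl, rfl⟩ hw
    (by simpa [hlen] using List.length_pos_iff.2 hne)
  simpa using h

theorem reducesTo_slide_crossing_rise (A : List ℤ) (x y k : ℤ) (N B : List ℤ) :
    ReducesTo (rise (A ++ [x, y]) k N B ++ [⟨A, .crossing x y, N ++ k :: B⟩])
      {⟨A, .crossing x y, k :: (N ++ B)⟩ :: rise (A ++ [y, x]) k N B} := by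
  have h := reducesTo_interchange_symm A [] [] (u := [⟨[], .crossing x y, []⟩]) ⟨rfl, rfl⟩
    (isPath_rise_bottom k N B) (by simp)
  simpa using h

theorem reducesTo_leftCusp_crossed_twice (k m : ℤ) (N B : List ℤ) :
    ReducesTo (leftCuspWord [] k (m :: N) B ++ [⟨[], .crossing (k + 1) m, N ++ k :: B⟩]) ∅ := by
  have h_slide := (reducesTo_slide_crossing_rise [] (k + 1) m k N B).congr_single
    [⟨[], .leftCusp k, m :: (N ++ B)⟩, ⟨[k + 1], .crossing k m, N ++ B⟩] []
  have h_move := (ReducesTo.of_spannedBy_lt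
      (LocalMove.reidemeister2_left_below [] (N ++ B) k m).spannedBy
      (by simp +arith [complexity, Prod.lt_iff])).congr_empty [] (rise [m, k + 1] k N B)
  simp only [leftCuspWord, rise_cons, List.append_nil, List.nil_append, List.cons_append]
    at h_slide h_move ⊢
  exact h_slide.step h_move

theorem reducesTo_leftCusp_crossing_strands (k x y : ℤ) (N B : List ℤ) :
    ReducesTo (leftCuspWord [] k (x :: y :: N) B ++ [⟨[k + 1], .crossing x y, N ++ k :: B⟩]) ∅ := by
  have h_slide := (reducesTo_slide_crossing_rise [k + 1] x y k N B).congr_single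
    [⟨[], .leftCusp k, x :: y :: (N ++ B)⟩, ⟨[k + 1], .crossing k x, y :: (N ++ B)⟩,
      ⟨[k + 1, x], .crossing k y, N ++ B⟩] []
  have h_move := (ReducesTo.of_spannedBy_le
      (LocalMove.reidemeister3 [k + 1] (N ++ B) k x y).spannedBy
      (by simp +arith [complexity])).congr_single
    [⟨[], .leftCusp k, x :: y :: (N ++ B)⟩] (rise [k + 1, y, x] k N B)
  have h_cusp := ((reducesTo_slide_leftCusp k (w := [⟨[], .crossing x y, []⟩]) ⟨rfl, rfl⟩
      (by simp) (by simp)).whisker [] (N ++ B)).congr []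
    (⟨[k + 1], .crossing k y, x :: (N ++ B)⟩ :: ⟨[k + 1, y], .crossing k x, N ++ B⟩ ::
      rise [k + 1, y, x] k N B)
  simp only [leftCuspWord, rise_cons, whisker_cons, whisker_nil, Set.image_empty, List.append_nil,
    List.nil_append, List.cons_append] at h_slide h_move h_cusp ⊢
  exact h_slide.step (h_move.step h_cusp)

theorem reducesTo_push_leftCuspWord (x k : ℤ) (N B : List ℤ) :
    ReducesTo (leftCuspWord [x] k N B ++ [⟨[], .crossing x (k + 1), N ++ k :: B⟩])
      {leftCuspWord [] k (x :: N) B} := by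
  have h_slide := (reducesTo_slide_crossing_rise [] x (k + 1) k N B).congr_single
    [⟨[x], .leftCusp k, N ++ B⟩] []
  have h_push := (reducesTo_push_leftCusp [] (N ++ B) k x).congr_single [] (rise [k + 1, x] k N B)
  simp only [leftCuspWord, rise_cons, List.append_nil, List.nil_append, List.cons_append]
    at h_slide h_push ⊢
  exact h_slide.step h_push

theorem reducesTo_leftCuspWord_rise_lower {k : ℤ} {M N B C : List ℤ}
    (h : M ++ C = N ++ k :: B) :
    ReducesTo (leftCuspWord [] k N B ++ rise [] (k + 1) M C)
      {w | StandardLeftCusp (N ++ B) w (M ++ (k + 1) :: C)} := by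
  rcases M with _ | ⟨m, M⟩
  · exact .of_mem ⟨[], k, N, B, rfl, by simp, by simpa using h⟩
  refine ReducesTo.of_empty ?_
  rcases N with _ | ⟨n, N⟩
  · obtain ⟨rfl, rfl⟩ : m = k ∧ M ++ C = B := by simpa using h
    have h_crossed := (ReducesTo.of_spannedBy_empty
      (spannedBy_crossed_leftCusp [] (M ++ C) m)).congr_empty [] (rise [m] (m + 1) M C)
    simpa [leftCuspWord, rise_cons] using h_crossed
  · obtain ⟨rfl, hMC⟩ : m = n ∧ M ++ C = N ++ k :: B := by simpa using h
    have h_crossed := (reducesTo_leftCusp_crossed_twice k m N B).congr_empty []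
      (rise [m] (k + 1) M C)
    simpa [rise_cons, hMC] using h_crossed

theorem reducesTo_leftCuspWord_rise_between {k x : ℤ} {M N B C : List ℤ}
    (h : M ++ C = N ++ k :: B) :
    ReducesTo (leftCuspWord [] k (x :: N) B ++ rise [k + 1] x M C)
      {w | StandardLeftCusp (x :: (N ++ B)) w ((k + 1) :: (M ++ x :: C))} := by
  rcases M with _ | ⟨m, M⟩
  · exact .of_mem ⟨[], k, x :: N, B, rfl, by simp, by simpa using h⟩
  refine ReducesTo.of_empty ?_
  rcases N with _ | ⟨n, N⟩
  · obtain ⟨rfl, rfl⟩ : m = k ∧ M ++ C = B := by simpa using h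
    have h_double := (reducesTo_double_crossing [m + 1] (M ++ C) m x).congr_empty
      [⟨[], .leftCusp m, x :: (M ++ C)⟩] (rise [m + 1, m] x M C)
    simpa [leftCuspWord, rise_cons] using h_double
  · obtain ⟨rfl, hMC⟩ : m = n ∧ M ++ C = N ++ k :: B := by simpa using h
    have h_cross := (reducesTo_leftCusp_crossing_strands k x m N B).congr_empty []
      (rise [k + 1, m] x M C)
    simpa [rise_cons, hMC] using h_cross

theorem reducesTo_leftCuspWord_rise_below {A M N B C : List ℤ} {k : ℤ} (x : ℤ)
    (h : M ++ C = A ++ (k + 1) :: (N ++ k :: B)) :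
    ReducesTo (leftCuspWord (x :: A) k N B ++ rise [] x M C)
      {w | StandardLeftCusp (x :: (A ++ (N ++ B))) w (M ++ x :: C)} := by
  rcases M with _ | ⟨m, M⟩
  · exact .of_mem ⟨x :: A, k, N, B, rfl, by simp, by simpa using h⟩
  rcases A with _ | ⟨a, A⟩
  · obtain ⟨rfl, hMC⟩ : m = k + 1 ∧ M ++ C = N ++ k :: B := by simpa using h
    have h_push := (reducesTo_push_leftCuspWord x k N B).congr_single [] (rise [k + 1] x M C)
    simp only [rise_cons, hMC, List.nil_append, List.append_assoc, List.cons_append] at h_push ⊢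
    exact h_push.step (reducesTo_leftCuspWord_rise_between hMC)
  · obtain ⟨rfl, hMC⟩ : m = a ∧ M ++ C = A ++ (k + 1) :: (N ++ k :: B) := by simpa using h
    have h_slide := (reducesTo_empty_interchange_symm [] [] [] (u := [⟨[], .crossing x m, []⟩])
      ⟨rfl, rfl⟩ (isPath_leftCuspWord A k N B) (by simp +arith)).congr_empty [] (rise [m] x M C)
    refine ReducesTo.of_empty ?_
    simpa [rise_cons, hMC, whisker_leftCuspWord] using h_slide

namespace StandardBraid

variable {A B Y : List ℤ} {k : ℤ} {p : List Basic}

theorem reducesTo_leftCusp_bottom (h : StandardBraid ((k + 1) :: k :: B) p Y) :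
    ReducesTo (⟨[], .leftCusp k, B⟩ :: p) {w | StandardLeftCusp B w Y} := by
  obtain ⟨M, C, _, hk, rfl, rfl⟩ := h.exists_of_cons
  obtain ⟨N, D, w, hw, rfl, hMC⟩ := hk.exists_of_cons
  rcases eq_or_ne w [] with rfl | hne
  · obtain rfl : B = N ++ D := hw.isPath
    simpa [leftCuspWord] using reducesTo_leftCuspWord_rise_lower hMC
  · refine ReducesTo.of_empty ?_
    have h_slide := (reducesTo_slide_leftCusp k hw.isPath (hw.isBraid.length_eq hw.isPath)
      hne).congr_empty [] (rise [k + 1] k N D ++ rise [] (k + 1) M C)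
    simpa using h_slide

theorem reducesTo_leftCusp (h : StandardBraid (A ++ (k + 1) :: k :: B) p Y) :
    ReducesTo (⟨A, .leftCusp k, B⟩ :: p) {w | StandardLeftCusp (A ++ B) w Y} := by
  induction A generalizing p Y with
  | nil => exact h.reducesTo_leftCusp_bottom
  | cons x A ih =>
    obtain ⟨M, C, w, hw, rfl, rfl⟩ := h.exists_of_cons
    have h_rest := ((ih hw).whisker [x] []).congr [] (rise [] x M C)
    simp only [whisker_cons, List.append_nil, List.nil_append, List.cons_append] at h_rest
    refine h_rest.trans ?_
    rintro _ ⟨_, ⟨_, ⟨A', l, N, D, hAB, rfl, hMC⟩, rfl⟩, rfl⟩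
    simpa [whisker_leftCuspWord, hAB] using reducesTo_leftCuspWord_rise_below x hMC

end StandardBraid

theorem append_pair_eq_append_pair {α : Type*} {A B C D : List α} {a b c d : α}
    (h : A ++ a :: b :: B = C ++ c :: d :: D) :
    (A = C ∧ a = c ∧ b = d ∧ B = D) ∨ (C = A ++ [a] ∧ b = c ∧ B = d :: D) ∨
      (A = C ++ [c] ∧ a = d ∧ D = b :: B) ∨ (∃ E, C = A ++ a :: b :: E ∧ B = E ++ c :: d :: D) ∨
      ∃ E, A = C ++ c :: d :: E ∧ D = E ++ a :: b :: B := by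
  rcases List.append_eq_append_iff.1 h with ⟨_ | ⟨e, _ | ⟨f, E⟩⟩, rfl, hE⟩ |
    ⟨_ | ⟨e, _ | ⟨f, E⟩⟩, rfl, hE⟩ <;> simp_all

theorem reducesTo_rightCusp_above (A E D : List ℤ) (e : Elem) (k : ℤ)
    (he : e.src.length ≤ e.tgt.length) :
    ReducesTo [⟨A, e, E ++ (k + 1) :: k :: D⟩, ⟨A ++ e.tgt ++ E, .rightCusp k, D⟩] ∅ := by
  have h := reducesTo_empty_interchange A E D (u := [⟨[], e, []⟩]) (v := [⟨[], .rightCusp k, []⟩])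
    ⟨rfl, rfl⟩ ⟨rfl, rfl⟩ (by cases e <;> simp_all)
  simpa using h

theorem reducesTo_rightCusp_below (C E B : List ℤ) (e : Elem) (k : ℤ)
    (he : e.src.length ≤ e.tgt.length) :
    ReducesTo [⟨C ++ (k + 1) :: k :: E, e, B⟩, ⟨C, .rightCusp k, E ++ e.tgt ++ B⟩] ∅ := by
  have h := reducesTo_empty_interchange_symm C E B (u := [⟨[], .rightCusp k, []⟩])
    (v := [⟨[], e, []⟩]) ⟨rfl, rfl⟩ ⟨rfl, rfl⟩ (by cases e <;> simp_all)
  simpa using h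

theorem reducesTo_leftCusp_rightCusp {A B C D : List ℤ} {n k : ℤ}
    (h : A ++ (n + 1) :: n :: B = C ++ (k + 1) :: k :: D) :
    ReducesTo [⟨A, .leftCusp n, B⟩, ⟨C, .rightCusp k, D⟩] ∅ := by
  rcases append_pair_eq_append_pair h with ⟨rfl, -, rfl, rfl⟩ | ⟨rfl, rfl, rfl⟩ |
    ⟨rfl, rfl, rfl⟩ | ⟨E, rfl, rfl⟩ | ⟨E, rfl, rfl⟩
  · exact .of_spannedBy_lt (spannedBy_unknot A B n) (by simp [complexity, Prod.lt_iff])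
  · exact .of_spannedBy_empty (spannedBy_zigzag A D k)
  · exact .of_spannedBy_empty (spannedBy_reflect_zigzag C B n)
  · simpa using reducesTo_rightCusp_above A E D (.leftCusp n) k (by simp)
  · simpa using reducesTo_rightCusp_below C E B (.leftCusp n) k (by simp)

theorem reducesTo_push_rightCusp (A B : List ℤ) (k n : ℤ) :
    ReducesTo [⟨A, .crossing (k + 1) n, k :: B⟩, ⟨A ++ [n], .rightCusp k, B⟩]
      {[⟨A ++ [k + 1], .crossing n k, B⟩, ⟨A, .rightCusp k, n :: B⟩]} := by
  simpa [Basic.mirror, Elem.mirror] using (reducesTo_push_leftCusp A B k n).reflect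

theorem reducesTo_crossed_rightCusp (A B : List ℤ) (n : ℤ) :
    ReducesTo [⟨A, .crossing n (n + 1), B⟩, ⟨A, .rightCusp n, B⟩] ∅ := by
  simpa [Basic.mirror, Elem.mirror] using
    (ReducesTo.of_spannedBy_empty (spannedBy_crossed_leftCusp A B n)).reflect

theorem reducesTo_leftCuspWord_rightCusp_above (A M D : List ℤ) (k m : ℤ) :
    ReducesTo (leftCuspWord A (k + 1) (M ++ [m]) (k :: D) ++
      [⟨A ++ (k + 1 + 1) :: (M ++ [m]), .rightCusp k, D⟩]) ∅ := by
  have h_push := (reducesTo_push_rightCusp (A ++ (k + 1 + 1) :: M) D k m).congr_single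
    (leftCuspWord A (k + 1) M (m :: k :: D)) []
  have h_slide := (reducesTo_empty_interchange [] [] D (v := [⟨[], .crossing m k, []⟩])
    (isPath_leftCuspWord A (k + 1) M []) ⟨rfl, rfl⟩ (by simp)).congr_empty []
    [⟨A ++ (k + 1 + 1) :: M, .rightCusp k, m :: D⟩]
  simp only [leftCuspWord, rise_append, rise_cons, rise_nil, whisker_cons, whisker_nil,
    whisker_rise, Basic.src, Elem.src, List.append_nil, List.append_assoc, List.nil_append,
    List.cons_append] at h_push h_slide ⊢
  exact h_push.step h_slide

theorem reducesTo_leftCuspWord_rightCusp_below {A M B C : List ℤ} {k n : ℤ}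
    (h : A ++ (n + 1) :: M = C ++ [k + 1]) :
    ReducesTo (leftCuspWord A n (M ++ [k]) B ++ [⟨C, .rightCusp k, n :: B⟩]) ∅ := by
  rcases List.eq_nil_or_concat' M with rfl | ⟨M, m, rfl⟩
  · obtain ⟨rfl, hnk⟩ := List.append_inj' h rfl
    obtain rfl : n = k := by simpa using hnk
    have h_unkink := (LocalMove.reidemeister1_below A B n).spannedBy
    exact .of_spannedBy_lt h_unkink (by simp [complexity, Prod.lt_iff])
  · rw [← List.cons_append, ← List.append_assoc] at h
    obtain ⟨rfl, hmk⟩ := List.append_inj' h rfl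
    obtain rfl : m = k + 1 := by simpa using hmk
    have h_move := (ReducesTo.of_spannedBy_lt
        (LocalMove.reidemeister2_right_below (A ++ (n + 1) :: M) B k n).spannedBy
        (by simp +arith [complexity, Prod.lt_iff])).congr_empty
      (leftCuspWord A n M ((k + 1) :: k :: B)) []
    simpa [leftCuspWord, rise_append, rise_cons] using h_move

theorem reducesTo_leftCuspWord_rightCusp {A M B C D : List ℤ} {n k : ℤ}
    (h : A ++ (n + 1) :: (M ++ n :: B) = C ++ (k + 1) :: k :: D) :
    ReducesTo (leftCuspWord A n M B ++ [⟨C, .rightCusp k, D⟩]) ∅ := by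
  rcases List.eq_nil_or_concat' M with rfl | ⟨M, m, rfl⟩
  · simpa [leftCuspWord] using reducesTo_leftCusp_rightCusp h
  have h_word : leftCuspWord A n (M ++ [m]) B = leftCuspWord A n M (m :: B) ++
      [⟨A ++ (n + 1) :: M, .crossing n m, B⟩] := by
    simp [leftCuspWord, rise_append, rise_cons]
  have h_ends : (A ++ (n + 1) :: M) ++ m :: n :: B = C ++ (k + 1) :: k :: D := by simpa using h
  rcases append_pair_eq_append_pair h_ends with ⟨rfl, rfl, rfl, rfl⟩ | ⟨rfl, rfl, rfl⟩ |
    ⟨hC, rfl, rfl⟩ | ⟨E, rfl, rfl⟩ | ⟨E, hC, rfl⟩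
  · have h_crossed := (reducesTo_crossed_rightCusp (A ++ (n + 1) :: M) B n).congr_empty
      (leftCuspWord A n M ((n + 1) :: B)) []
    simpa [h_word] using h_crossed
  · simpa using reducesTo_leftCuspWord_rightCusp_above A M D k m
  · exact reducesTo_leftCuspWord_rightCusp_below hC
  · have h_slide := (reducesTo_rightCusp_above (A ++ (n + 1) :: M) E D (.crossing n m) k
      (by simp)).congr_empty (leftCuspWord A n M (m :: (E ++ (k + 1) :: k :: D))) []
    simpa [h_word] using h_slide
  · have h_slide := (reducesTo_rightCusp_below C E B (.crossing n m) k
      (by simp)).congr_empty (leftCuspWord A n M (m :: B)) []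
    simpa [h_word, hC] using h_slide

namespace StandardLeftCusp

variable {X C D : List ℤ} {a b k : ℤ} {w : List Basic}

theorem reducesTo_rightCusp (h : StandardLeftCusp X w (C ++ (k + 1) :: k :: D)) :
    ReducesTo (w ++ [⟨C, .rightCusp k, D⟩]) ∅ := by
  obtain ⟨A, n, M, B, rfl, rfl, h_ends⟩ := h
  exact reducesTo_leftCuspWord_rightCusp h_ends.symm

theorem reducesTo_crossing (h : StandardLeftCusp X w (C ++ a :: b :: D)) :
    ReducesTo (w ++ [⟨C, .crossing a b, D⟩])
      {s | StandardLeftCusp X s (C ++ b :: a :: D)} := by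
  obtain ⟨A, k, M, B, rfl, rfl, h_ends⟩ := h
  have h_braid : IsBraid (rise (A ++ [k + 1]) k M B ++ [⟨C, .crossing a b, D⟩]) :=
    List.forall_mem_append.2 ⟨isBraid_rise _ _ _ _, by simp [Elem.IsCrossing]⟩
  have h_path : IsPath (A ++ (k + 1) :: k :: (M ++ B))
      (rise (A ++ [k + 1]) k M B ++ [⟨C, .crossing a b, D⟩]) (C ++ b :: a :: D) := by
    refine isPath_append (Y := C ++ a :: b :: D) ?_ ⟨by simp, by simp [IsPath]⟩
    rw [h_ends]
    simpa using isPath_rise (A ++ [k + 1]) k M B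
  have h_reduce := (h_braid.reducesTo h_path).congr [⟨A, .leftCusp k, M ++ B⟩] []
  simp only [List.append_nil, List.cons_append, List.nil_append] at h_reduce
  refine ReducesTo.trans h_reduce ?_
  rintro _ ⟨p, hp, rfl⟩
  exact StandardBraid.reducesTo_leftCusp hp

theorem reducesTo_reflect_leftCusp (h : StandardLeftCusp X w (C ++ (k + 1) :: k :: D)) :
    ReducesTo (⟨C, .leftCusp k, D⟩ :: reflect w) ∅ := by
  simpa [Basic.mirror, Elem.mirror] using h.reducesTo_rightCusp.reflect

theorem reducesTo_reflect_crossing (h : StandardLeftCusp X w (C ++ a :: b :: D)) :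
    ReducesTo (⟨C, .crossing b a, D⟩ :: reflect w)
      (reflect '' {s | StandardLeftCusp X s (C ++ b :: a :: D)}) := by
  simpa [Basic.mirror, Elem.mirror] using h.reducesTo_crossing.reflect

end StandardLeftCusp

/-! ### Standard words -/

/-- Compositions of standard words for right cusp tangles, for a permutation braid and for left cusp
tangles, in this order. -/
inductive StandardWord : List ℤ → List Basic → List ℤ → Prop
  | braid {X Y : List ℤ} {w : List Basic} : StandardBraid X w Y → StandardWord X w Y
  | rightCusp_append {X X' Y : List ℤ} {v w : List Basic} : StandardLeftCusp X v X' →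
      StandardWord X w Y → StandardWord X' (reflect v ++ w) Y
  | append_leftCusp {X Y Y' : List ℤ} {w v : List Basic} : StandardWord X w Y →
      StandardLeftCusp Y v Y' → StandardWord X (w ++ v) Y'

theorem standardLeftCusp_singleton (A B : List ℤ) (k : ℤ) :
    StandardLeftCusp (A ++ B) [⟨A, .leftCusp k, B⟩] (A ++ (k + 1) :: k :: B) :=
  ⟨A, k, [], B, rfl, rfl, rfl⟩

theorem ReducesTo.append_leftCusp {X Y Y' : List ℤ} {w v : List Basic}
    (h : ReducesTo w {t | StandardWord X t Y}) (hv : StandardLeftCusp Y v Y') :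
    ReducesTo (w ++ v) {t | StandardWord X t Y'} := by
  refine (by simpa using h.congr [] v : ReducesTo (w ++ v) _).mono ?_
  rintro _ ⟨t, ht, rfl⟩
  exact .append_leftCusp ht hv

namespace StandardWord

variable {Y A B : List ℤ} {a b k : ℤ} {w : List Basic}

theorem refl (X : List ℤ) : StandardWord X [] X := .braid (.refl X)

theorem reducesTo_crossing (h : StandardWord (A ++ b :: a :: B) w Y) :
    ReducesTo (⟨A, .crossing a b, B⟩ :: w) {t | StandardWord (A ++ a :: b :: B) t Y} := by
  generalize hX : A ++ b :: a :: B = X at h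
  induction h with
  | braid h =>
    subst hX
    exact h.reducesTo_crossing.mono fun _ => .braid
  | @rightCusp_append X _ Y v w hv hw =>
    subst hX
    have h_push := hv.reducesTo_reflect_crossing.congr [] w
    simp only [List.nil_append, List.cons_append] at h_push
    refine h_push.mono ?_
    rintro _ ⟨_, ⟨s, hs, rfl⟩, rfl⟩
    exact .rightCusp_append hs hw
  | append_leftCusp _ hv ih => exact (ih hX).append_leftCusp hv

theorem reducesTo_leftCusp (h : StandardWord (A ++ (k + 1) :: k :: B) w Y) :
    ReducesTo (⟨A, .leftCusp k, B⟩ :: w) {t | StandardWord (A ++ B) t Y} := by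
  generalize hX : A ++ (k + 1) :: k :: B = X at h
  induction h with
  | braid h =>
    subst hX
    exact h.reducesTo_leftCusp.mono fun _ => .append_leftCusp (refl _)
  | @rightCusp_append X _ Y v w hv _ =>
    subst hX
    simpa using (hv.reducesTo_reflect_leftCusp.congr_empty [] w).of_empty
  | append_leftCusp _ hv ih => exact (ih hX).append_leftCusp hv

theorem reducesTo_cons {b : Basic} (h : StandardWord b.tgt w Y) :
    ReducesTo (b :: w) {t | StandardWord b.src t Y} := by
  rcases b with ⟨A, ⟨m, n⟩ | k | k, B⟩
  · simpa using reducesTo_crossing (by simpa using h)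
  · simpa using reducesTo_leftCusp (by simpa using h)
  · refine .of_mem ?_
    simpa [Basic.mirror, Elem.mirror] using
      rightCusp_append (standardLeftCusp_singleton A B k) (by simpa using h)

end StandardWord

theorem IsPath.reducesTo {X Y : List ℤ} {w : List Basic} (h : IsPath X w Y) :
    ReducesTo w {t | StandardWord X t Y} := by
  induction w generalizing X with
  | nil =>
    cases h
    exact .of_mem (.refl _)
  | cons b w ih =>
    obtain ⟨rfl, h⟩ := h
    have h_rest := (ih h).congr [b] []
    simp only [List.append_nil, List.cons_append, List.nil_append] at h_rest
    refine ReducesTo.trans h_rest ?_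
    rintro _ ⟨s, hs, rfl⟩
    exact hs.reducesTo_cons

theorem skeinClass_mem_span_standardWord (X Y : List ℤ) (w : List Basic) :
    skeinClass X Y w ∈ Submodule.span SkeinRing (skeinClass X Y '' {t | StandardWord X t Y}) := by
  induction hc : complexity w using WellFoundedLT.induction generalizing w with
  | _ c ih =>
    subst hc
    by_cases hw : IsPath X w Y
    · have h_reduce := hw.reducesTo X Y [] [] [] []
      simp only [whisker_nil_nil, List.nil_append, List.append_nil] at h_reduce
      refine Submodule.span_le.2 ?_ h_reduce
      rintro _ ⟨s, hs | ⟨hs, -⟩, rfl⟩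
      · exact ih _ hs s rfl
      · exact Submodule.subset_span ⟨s, hs, rfl⟩
    · rw [skeinClass_of_not_isPath hw]
      exact Submodule.zero_mem _

/-! ### Crossing numbers of braids -/

/-- The permutation of heights, from left to right, induced by a word of crossings. -/
def strandPerm : List Basic → Equiv.Perm ℕ
  | [] => 1
  | b :: w => strandPerm w * Equiv.swap b.lower.length (b.lower.length + 1)

theorem strandPerm_append (v w : List Basic) :
    strandPerm (v ++ w) = strandPerm w * strandPerm v := by
  induction v with
  | nil => rfl
  | cons b v ih => rw [List.cons_append, strandPerm, ih, strandPerm, mul_assoc]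

theorem strandPerm_reflect_apply (w : List Basic) (i : ℕ) :
    strandPerm (reflect w) (strandPerm w i) = i := by
  induction w generalizing i with
  | nil => rfl
  | cons b w ih => simp [strandPerm_append, strandPerm, Basic.mirror, ih]

theorem strandPerm_whisker_add (A B : List ℤ) (w : List Basic) (i : ℕ) :
    strandPerm (whisker A B w) (A.length + i) = A.length + strandPerm w i := by
  induction w generalizing i with
  | nil => rfl
  | cons b w ih =>
    simp [strandPerm, (add_right_injective A.length).swap_apply, add_assoc, ih]

theorem follow_of_isCrossing {b : Basic} (hb : b.elem.IsCrossing) (i : ℕ) :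
    b.follow i = some (Equiv.swap b.lower.length (b.lower.length + 1) i) := by
  rcases b with ⟨A, _ | _ | _, B⟩
  · simp only [Basic.follow, Equiv.swap_apply_def]
    split_ifs <;> rfl
  · exact hb.elim
  · exact hb.elim

theorem crossingNumber_cons {b : Basic} (hb : b.elem.IsCrossing) (w : List Basic) (i j : ℕ) :
    crossingNumber (b :: w) i j =
      (if s(i, j) = s(b.lower.length, b.lower.length + 1) then 1 else 0) +
        crossingNumber w (strandPerm [b] i) (strandPerm [b] j) := by
  simp [crossingNumber, follow_of_isCrossing hb, Basic.Crosses, hb, strandPerm, and_comm]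

theorem crossingNumber_singleton_of_not_isCrossing {b : Basic} (hb : ¬ b.elem.IsCrossing)
    (i j : ℕ) : crossingNumber [b] i j = 0 := by
  simp only [crossingNumber, Basic.Crosses, hb, false_and, if_false, zero_add]
  cases b.follow i <;> cases b.follow j <;> rfl

theorem crossingNumber_rise (A : List ℤ) (x : ℤ) (M B : List ℤ) (i j : ℕ) :
    crossingNumber (rise A x M B) i j =
      if (i = A.length ∧ A.length < j ∧ j ≤ A.length + M.length) ∨
        (j = A.length ∧ A.length < i ∧ i ≤ A.length + M.length) then 1 else 0 := by
  induction M generalizing A i j with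
  | nil =>
    rw [rise_nil, if_neg (by simp)]
    rfl
  | cons m M ih =>
    rw [rise, crossingNumber_cons (by exact trivial), ih]
    simp only [strandPerm, one_mul, Equiv.swap_apply_def, Sym2.eq_iff, List.length_append,
      List.length_cons, List.length_nil]
    split_ifs <;> omega

namespace IsBraid

variable {w : List Basic}

theorem followWord_eq (hw : IsBraid w) (i : ℕ) : followWord w i = some (strandPerm w i) := by
  induction w generalizing i with
  | nil => rfl
  | cons b w ih =>
    obtain ⟨hb, hw⟩ := List.forall_mem_cons.1 hw
    rw [followWord, follow_of_isCrossing hb]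
    exact ih hw _

theorem crossingNumber_append (hw : IsBraid w) (v : List Basic) (i j : ℕ) :
    crossingNumber (w ++ v) i j =
      crossingNumber w i j + crossingNumber v (strandPerm w i) (strandPerm w j) := by
  induction w generalizing i j with
  | nil => simp [crossingNumber, strandPerm]
  | cons b w ih =>
    obtain ⟨hb, hw⟩ := List.forall_mem_cons.1 hw
    rw [List.cons_append, crossingNumber_cons hb, crossingNumber_cons hb, ih hw, add_assoc]
    rfl

theorem crossingNumber_comm (hw : IsBraid w) (i j : ℕ) :
    crossingNumber w i j = crossingNumber w j i := by
  induction w generalizing i j with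
  | nil => rfl
  | cons b w ih =>
    obtain ⟨hb, hw⟩ := List.forall_mem_cons.1 hw
    rw [crossingNumber_cons hb, crossingNumber_cons hb, ih hw, Sym2.eq_swap]

theorem crossingNumber_whisker_add (hw : IsBraid w) (A B : List ℤ) (i j : ℕ) :
    crossingNumber (whisker A B w) (A.length + i) (A.length + j) =
      crossingNumber w i j := by
  induction w generalizing i j with
  | nil => rfl
  | cons b w ih =>
    obtain ⟨hb, hw⟩ := List.forall_mem_cons.1 hw
    have h_perm := strandPerm_whisker_add A B [b]
    simp only [whisker_cons, whisker_nil] at h_perm ⊢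
    rw [crossingNumber_cons (by exact hb), crossingNumber_cons hb, h_perm, h_perm, ih hw]
    simp [add_assoc]

theorem crossingNumber_whisker_of_lt (hw : IsBraid w) (A B : List ℤ) {i : ℕ} (hi : i < A.length)
    (j : ℕ) : crossingNumber (whisker A B w) i j = 0 := by
  induction w generalizing j with
  | nil => rfl
  | cons b w ih =>
    obtain ⟨hb, hw⟩ := List.forall_mem_cons.1 hw
    have h_fix : strandPerm [⟨A ++ b.lower, b.elem, b.upper ++ B⟩] i = i :=
      Equiv.swap_apply_of_ne_of_ne (by simp; omega) (by simp; omega)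
    rw [whisker_cons, crossingNumber_cons (by exact hb), h_fix, ih hw]
    simp
    omega

theorem crossingNumber_reflect (hw : IsBraid w) (i j : ℕ) :
    crossingNumber (reflect w) (strandPerm w i) (strandPerm w j) =
      crossingNumber w i j := by
  induction w generalizing i j with
  | nil => rfl
  | cons b w ih =>
    obtain ⟨hb, hw⟩ := List.forall_mem_cons.1 hw
    have h_last (k l : ℕ) : crossingNumber [b.mirror] (strandPerm [b] k) (strandPerm [b] l) =
        if s(k, l) = s(b.lower.length, b.lower.length + 1) then 1 else 0 := by
      rw [crossingNumber_cons (Elem.isCrossing_mirror_iff.2 hb)]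
      simp only [crossingNumber, strandPerm, one_mul, Basic.mirror, Equiv.swap_apply_def,
        Sym2.eq_iff]
      split_ifs <;> omega
    have h_split (k : ℕ) : strandPerm (b :: w) k = strandPerm w (strandPerm [b] k) := rfl
    rw [reflect_cons, crossingNumber_append (isBraid_reflect_iff.2 hw), h_split, h_split, ih hw,
      strandPerm_reflect_apply, strandPerm_reflect_apply, h_last,
      crossingNumber_cons hb, add_comm]

end IsBraid

theorem StandardBraid.crossingNumber_le_one {X Y : List ℤ} {w : List Basic}
    (h : StandardBraid X w Y) (i j : ℕ) : crossingNumber w i j ≤ 1 := by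
  induction h generalizing i j with
  | nil => simp [crossingNumber]
  | @cons X w x M B h ih =>
    have hw := h.isBraid
    have h_zero (j : ℕ) : crossingNumber (whisker [x] [] w) 0 j = 0 :=
      hw.crossingNumber_whisker_of_lt [x] [] Nat.one_pos j
    rw [(isBraid_whisker_iff.2 hw).crossingNumber_append, crossingNumber_rise]
    rcases i with _ | i
    · rw [h_zero]
      split_ifs <;> omega
    rcases j with _ | j
    · rw [(isBraid_whisker_iff.2 hw).crossingNumber_comm, h_zero]
      split_ifs <;> omega
    have h_number := hw.crossingNumber_whisker_add [x] [] i j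
    have h_perm := strandPerm_whisker_add [x] [] w
    simp only [List.length_singleton, add_comm 1] at h_number h_perm
    simpa [h_number, h_perm] using ih i j

/-! ### Normal forms -/

theorem StandardLeftCusp.isLeftCuspTangle {X Y : List ℤ} {T : Tangle X Y}
    (h : StandardLeftCusp X T.word Y) : T.IsLeftCuspTangle := by
  obtain ⟨A, k, M, B, -, hT, -⟩ := h
  set r := rise (A ++ [k + 1]) k M B with hr
  have h_braid : IsBraid r := isBraid_rise _ _ _ _
  have h_reflect : IsBraid (reflect r) := isBraid_reflect_iff.2 h_braid
  have h_word : T.mirror.word = reflect r ++ [⟨A, .rightCusp k, M ++ B⟩] := by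
    rw [show T.mirror.word = reflect T.word from rfl, hT, leftCuspWord, reflect_cons]
    rfl
  have h_follow (p : ℕ) : followWord (reflect r) (strandPerm r p) = some p := by
    rw [h_reflect.followWord_eq, strandPerm_reflect_apply]
  have h_number (a b : ℕ) :
      crossingNumber T.mirror.word (strandPerm r a) (strandPerm r b) = crossingNumber r a b := by
    rw [h_word, h_reflect.crossingNumber_append, h_braid.crossingNumber_reflect,
      crossingNumber_singleton_of_not_isCrossing (by exact fun h => h), add_zero]
  simp only [hr, crossingNumber_rise] at h_number
  refine ⟨reflect r, [], A, M ++ B, k, strandPerm r A.length, strandPerm r (A.length + 1),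
    by rw [h_word, List.append_nil], by rwa [List.append_nil], h_follow _, h_follow _,
    ?_, fun a b => ?_, fun a b => ?_⟩
  · rw [h_number]
    simp
  · obtain ⟨a, rfl⟩ := (strandPerm r).surjective a
    obtain ⟨b, rfl⟩ := (strandPerm r).surjective b
    intro _ ha _ hb
    rw [(strandPerm r).injective.ne_iff] at ha hb
    rw [h_number]
    simp [ha, hb]
  · obtain ⟨a, rfl⟩ := (strandPerm r).surjective a
    obtain ⟨b, rfl⟩ := (strandPerm r).surjective b
    rw [h_number]
    split_ifs <;> omega

namespace Tangle

theorem id_comp {X Y : List ℤ} (T : Tangle X Y) : (Tangle.id X).comp T = T := rfl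

theorem comp_id {X Y : List ℤ} (T : Tangle X Y) : T.comp (Tangle.id Y) = T :=
  Tangle.ext (List.append_nil _)

theorem comp_assoc {X Y Z Z' : List ℤ} (S : Tangle X Y) (T : Tangle Y Z) (U : Tangle Z Z') :
    (S.comp T).comp U = S.comp (T.comp U) :=
  Tangle.ext (List.append_assoc _ _ _)

theorem IsLeftCuspSequence.comp_right {X Y Z : List ℤ} {S : Tangle X Y} {T : Tangle Y Z}
    (hS : S.IsLeftCuspSequence) (hT : T.IsLeftCuspTangle) : (S.comp T).IsLeftCuspSequence := by
  induction hS with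
  | id X =>
    rw [id_comp, ← comp_id T]
    exact .comp _ _ hT (.id Z)
  | comp S S' hS _ ih =>
    rw [comp_assoc]
    exact .comp _ _ hS (ih hT)

theorem IsPermutationBraid.isNormalForm {X Y : List ℤ} {T : Tangle X Y}
    (hT : T.IsPermutationBraid) : T.IsNormalForm :=
  ⟨X, Y, .id X, T, .id Y, .id X, hT, .id Y, by rw [comp_id, id_comp]⟩

theorem IsNormalForm.comp_left {X Y Z : List ℤ} {S : Tangle X Y} {T : Tangle Y Z}
    (hT : T.IsNormalForm) (hS : S.IsRightCuspTangle) : (S.comp T).IsNormalForm := by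
  obtain ⟨X', Y', R, P, L, hR, hP, hL, rfl⟩ := hT
  exact ⟨X', Y', S.comp R, P, L, .comp S R hS hR, hP, hL, by simp only [comp_assoc]⟩

theorem IsNormalForm.comp_right {X Y Z : List ℤ} {S : Tangle X Y} {T : Tangle Y Z}
    (hS : S.IsNormalForm) (hT : T.IsLeftCuspTangle) : (S.comp T).IsNormalForm := by
  obtain ⟨X', Y', R, P, L, hR, hP, hL, rfl⟩ := hS
  exact ⟨X', Y', R, P, L.comp T, hR, hP, hL.comp_right hT, by simp only [comp_assoc]⟩

end Tangle

theorem StandardWord.exists_isNormalForm {X Y : List ℤ} {w : List Basic}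
    (h : StandardWord X w Y) : ∃ T : Tangle X Y, T.word = w ∧ T.IsNormalForm := by
  induction h with
  | @braid X Y w h =>
    exact ⟨⟨w, h.isPath⟩, rfl, Tangle.IsPermutationBraid.isNormalForm
      ⟨h.isBraid, h.crossingNumber_le_one⟩⟩
  | @rightCusp_append X X' Y v w hv _ ih =>
    obtain ⟨T, rfl, hT⟩ := ih
    let S : Tangle X X' := ⟨v, hv.isPath⟩
    exact ⟨S.mirror.comp T, rfl, hT.comp_left (hv.isLeftCuspTangle (T := S))⟩
  | @append_leftCusp X Y Y' w v _ hv ih =>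
    obtain ⟨S, rfl, hS⟩ := ih
    let T : Tangle Y Y' := ⟨v, hv.isPath⟩
    exact ⟨S.comp T, rfl, hS.comp_right (hv.isLeftCuspTangle (T := T))⟩

theorem toSkein_mem_span_isNormalForm {X Y : List ℤ} (T : Tangle X Y) :
    T.toSkein ∈ Submodule.span SkeinRing
      {x : Skein X Y | ∃ T : Tangle X Y, T.IsNormalForm ∧ T.toSkein = x} := by
  rw [← skeinClass_of_isPath T.isPath]
  refine Submodule.span_mono ?_ (skeinClass_mem_span_standardWord X Y T.word)
  rintro _ ⟨w, hw, rfl⟩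
  obtain ⟨S, rfl, hS⟩ := hw.exists_isNormalForm
  exact ⟨S, hS, (skeinClass_of_isPath S.isPath).symm⟩

theorem span_range_toSkein (X Y : List ℤ) :
    Submodule.span SkeinRing (Set.range (Tangle.toSkein (X := X) (Y := Y))) = ⊤ := by
  have h_class : Function.Surjective (Tangle.isotopyClass (X := X) (Y := Y)) := Quot.mk_surjective
  have h_free : Submodule.span SkeinRing (Set.range (Tangle.free (X := X) (Y := Y))) = ⊤ := by
    have h_basis := (Finsupp.basisSingleOne (R := SkeinRing) (ι := IsotopyClass X Y)).span_eq
    rwa [Finsupp.coe_basisSingleOne, ← h_class.range_comp] at h_basis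
  have h_range : Set.range (Tangle.toSkein (X := X) (Y := Y)) =
      Submodule.mkQ _ '' Set.range Tangle.free := (Set.range_comp _ _)
  rw [h_range, Submodule.span_image, h_free, Submodule.map_top, Submodule.range_mkQ]

end LegendrianTangle

theorem proposition3p3 (X Y : List ℤ) :
    Submodule.span LegendrianTangle.SkeinRing
      {x : LegendrianTangle.Skein X Y |
        ∃ T : LegendrianTangle.Tangle X Y, T.IsNormalForm ∧ T.toSkein = x} = ⊤ := by
  rw [eq_top_iff, ← LegendrianTangle.span_range_toSkein X Y, Submodule.span_le]
  rintro _ ⟨T, rfl⟩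
  exact LegendrianTangle.toSkein_mem_span_isNormalForm T
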